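/- Let $\mathfrak g$ be a finite-dimensional complex Lie algebra. Let $\mathrm{Sym}^{1,1}(\mathfrak g)\subset\mathfrak g\otimes\bar{\mathfrak g}$ be the real vector space of Hermitian forms on $\mathfrak g^*$, that is, of sesquilinear forms $h$ on $\mathfrak g^*$ with $h(\xi,\bar\eta)=\overline{h(\eta,\bar\xi)}$. Such a form is positive definite if $h(\xi,\bar\xi)>0$ for all nonzero $\xi\in\mathfrak g^*$, and $h<k$ means that $k-h$ is positive definite. Let $\#$ be the bilinear operation on $\mathfrak g\otimes\bar{\mathfrak g}$ with $$(v_1\otimes\bar v_2)\#(w_1\otimes\bar w_2)=[v_1,w_1]\otimes\overline{[v_2,w_2]},$$ and for $h\in\mathrm{Sym}^{1,1}(\mathfrak g)$ put $h^\#:=\tfrac12\,h\#h\in\mathrm{Sym}^{1,1}(\mathfrak g)$. Theorem. For every positive definite $h_0\in\mathrm{Sym}^{1,1}(\mathfrak g)$ the ODE $$\partial_t h=h^\#,\qquad h(0)=h_0$$ has a unique solution $h(t)\in\mathrm{Sym}^{1,1}(\mathfrak g)$ on a maximal time interval $[0,t_{\max})$, $0<t_{\max}\le+\infty$. The following are equivalent: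 1. $\mathfrak g$ is solvable; 2. for every positive definite initial condition $h_0$ the solution has at most exponential growth, i.e. $t_{\max}=+\infty$ and there are real constants $C,K$ such that $h(t)<Ce^{Kt}h_0$ for all $t\ge 0$; 3. for some positive definite initial condition $h_0$ the solution exists on $[0,+\infty)$, i.e. $t_{\max}=+\infty$. Moreover, if $\mathfrak g$ is not solvable, then for every positive definite $h_0$ the solution blows up in finite time: $t_{\max}<+\infty$, and $h(t)(\xi,\bar\xi)\to+\infty$ as $t\to t_{\max}$ from below for some $\xi\in\mathfrak g^*$. -/

import Mathlib

open scoped ComplexConjugate Topology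

noncomputable section

namespace HermitianFlow

variable (V : Type*) [AddCommGroup V] [Module ℂ V]

/-- The sesquilinear forms on `V^*`: linear in the first argument, conjugate-linear in the second.
For `V` of finite dimension this is `V ⊗ V̄`. -/
abbrev Sesq : Type _ := Module.Dual ℂ V →ₗ[ℂ] Module.Dual ℂ V →ₗ⋆[ℂ] ℂ

variable {V}

/-- The element `v ⊗ w̄`, that is, the form `(ξ, η) ↦ ξ v * conj (η w)`. -/
def tens (v w : V) : Sesq V :=
  LinearMap.mk₂'ₛₗ (RingHom.id ℂ) (starRingEnd ℂ) (fun ξ η => ξ v * conj (η w))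
    (by intros; simp [add_mul]) (by intros; simp [mul_assoc])
    (by intros; simp [mul_add]) (by intros; simp [mul_left_comm])

@[simp] theorem tens_apply (v w : V) (ξ η : Module.Dual ℂ V) :
    tens v w ξ η = ξ v * conj (η w) := rfl

variable (V) in
/-- `Sym^{1,1}(V)`, the real vector space of Hermitian forms on `V^*`. -/
def Sym11 : Submodule ℝ (Sesq V) where
  carrier := {h | ∀ ξ η, h ξ η = conj (h η ξ)}
  add_mem' := by
    intro a b ha hb ξ η
    simp [← ha ξ η, ← hb ξ η]
  zero_mem' := by intro ξ η; simp
  smul_mem' := by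
    intro c a ha ξ η
    simp [← ha ξ η]

/-- A Hermitian form `h` is positive definite if `h(ξ, ξ̄) > 0` for all nonzero `ξ ∈ V^*`
(the number `h(ξ, ξ̄)` is real). -/
def IsPos (h : Sym11 V) : Prop :=
  ∀ ξ : Module.Dual ℂ V, ξ ≠ 0 → 0 < ((h : Sesq V) ξ ξ).re

/-- The strict order on Hermitian forms: `h < k` means that `k - h` is positive definite. -/
def FormLT (h k : Sym11 V) : Prop := IsPos (k - h)

variable {𝔤 : Type*} [LieRing 𝔤] [LieAlgebra ℂ 𝔤]

/-- The formula for `h # k` in a basis `b` of `𝔤`, obtained from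
`(v₁ ⊗ v̄₂) # (w₁ ⊗ w̄₂) = [v₁, w₁] ⊗ [v̄₂, w̄₂]` by bilinear extension, where
`h = ∑ h(bᵢ*, bⱼ*) bᵢ ⊗ b̄ⱼ`. -/
def sharpBasis {ι : Type*} [Fintype ι] (b : Module.Basis ι ℂ 𝔤) :
    Sesq 𝔤 →ₗ[ℂ] Sesq 𝔤 →ₗ[ℂ] Sesq 𝔤 :=
  LinearMap.mk₂ ℂ
    (fun h k => ∑ i, ∑ j, ∑ l, ∑ m,
      (h (b.coord i) (b.coord j) * k (b.coord l) (b.coord m)) • tens ⁅b i, b l⁆ ⁅b j, b m⁆)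
    (by intros; simp only [LinearMap.add_apply, add_mul, add_smul, Finset.sum_add_distrib])
    (by intros; simp only [LinearMap.smul_apply, smul_eq_mul, mul_assoc, mul_smul,
          Finset.smul_sum])
    (by intros; simp only [LinearMap.add_apply, mul_add, add_smul, Finset.sum_add_distrib])
    (by intros; simp only [LinearMap.smul_apply, smul_eq_mul, mul_left_comm, mul_smul,
          Finset.smul_sum])

theorem sharpBasis_apply {ι : Type*} [Fintype ι] (b : Module.Basis ι ℂ 𝔤) (h k : Sesq 𝔤) :
    sharpBasis b h k = ∑ i, ∑ j, ∑ l, ∑ m,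
      (h (b.coord i) (b.coord j) * k (b.coord l) (b.coord m)) •
        tens ⁅b i, b l⁆ ⁅b j, b m⁆ := rfl

theorem sharpBasis_tens {ι : Type*} [Fintype ι] (b : Module.Basis ι ℂ 𝔤) (v₁ v₂ w₁ w₂ : 𝔤) :
    sharpBasis b (tens v₁ v₂) (tens w₁ w₂) = tens ⁅v₁, w₁⁆ ⁅v₂, w₂⁆ := by
  have key : ∀ (ζ : Module.Dual ℂ 𝔤) (v w : 𝔤),
      ζ ⁅v, w⁆ = ∑ i, ∑ l, b.repr v i * (b.repr w l * ζ ⁅b i, b l⁆) := by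
    intro ζ v w
    conv_lhs => rw [← b.sum_repr v, ← b.sum_repr w]
    simp only [sum_lie, lie_sum, smul_lie, lie_smul, map_sum, map_smul,
      smul_eq_mul, Finset.mul_sum]
    rw [Finset.sum_comm]
    exact Finset.sum_congr rfl fun i _ => Finset.sum_congr rfl fun j _ => by ring
  ext ξ η
  simp only [sharpBasis_apply, LinearMap.sum_apply, LinearMap.smul_apply, tens_apply,
    smul_eq_mul, Module.Basis.coord_apply]
  rw [key ξ, key η, map_sum, Finset.sum_mul_sum]
  refine Finset.sum_congr rfl fun i _ => Finset.sum_congr rfl fun j _ => ?_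
  rw [map_sum, Finset.sum_mul_sum]
  refine Finset.sum_congr rfl fun l _ => Finset.sum_congr rfl fun m _ => ?_
  simp only [map_mul]
  ring

theorem sesq_eq_sum {ι : Type*} [Fintype ι] (b : Module.Basis ι ℂ 𝔤) (h : Sesq 𝔤) :
    h = ∑ i, ∑ j, h (b.coord i) (b.coord j) • tens (b i) (b j) := by
  ext ξ η
  conv_lhs => rw [← b.sum_dual_apply_smul_coord ξ, ← b.sum_dual_apply_smul_coord η]
  simp only [map_sum, map_smul, map_smulₛₗ, LinearMap.sum_apply, LinearMap.smul_apply,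
    tens_apply, smul_eq_mul]
  simp only [Finset.mul_sum]
  rw [Finset.sum_comm]
  refine Finset.sum_congr rfl fun i _ => Finset.sum_congr rfl fun j _ => ?_
  ring

variable [FiniteDimensional ℂ 𝔤]

/-- The bilinear operation `#` on `𝔤 ⊗ 𝔤̄`. It does not depend on the basis (`sharp_eq`) and is
characterized by its values on the elements `v ⊗ w̄` (`sharp_tens`). -/
def sharp : Sesq 𝔤 →ₗ[ℂ] Sesq 𝔤 →ₗ[ℂ] Sesq 𝔤 := sharpBasis (Module.finBasis ℂ 𝔤)

theorem sharp_tens (v₁ v₂ w₁ w₂ : 𝔤) :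
    sharp (tens v₁ v₂) (tens w₁ w₂) = tens ⁅v₁, w₁⁆ ⁅v₂, w₂⁆ :=
  sharpBasis_tens _ _ _ _ _

theorem sharp_eq {ι : Type*} [Fintype ι] (b : Module.Basis ι ℂ 𝔤) (h k : Sesq 𝔤) :
    sharp h k = sharpBasis b h k := by
  conv_lhs => rw [sesq_eq_sum b h, sesq_eq_sum b k]
  conv_rhs => rw [sesq_eq_sum b h, sesq_eq_sum b k]
  simp only [map_sum, map_smul, LinearMap.sum_apply, LinearMap.smul_apply, sharp_tens,
    sharpBasis_tens]

theorem sharp_mem (h k : Sym11 𝔤) : sharp (h : Sesq 𝔤) (k : Sesq 𝔤) ∈ Sym11 𝔤 := by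
  intro ξ η
  simp only [sharp, sharpBasis_apply, LinearMap.sum_apply, LinearMap.smul_apply, tens_apply,
    smul_eq_mul, map_sum]
  rw [Finset.sum_comm]
  refine Finset.sum_congr rfl fun i _ => Finset.sum_congr rfl fun j _ => ?_
  rw [Finset.sum_comm]
  refine Finset.sum_congr rfl fun l _ => Finset.sum_congr rfl fun m _ => ?_
  rw [h.2, k.2]
  simp only [map_mul, Complex.conj_conj]
  ring

/-- `h^# = (1/2) h # h` for a Hermitian form `h`. -/
def sharpSq (h : Sym11 𝔤) : Sym11 𝔤 :=
  (1 / 2 : ℝ) • ⟨sharp (h : Sesq 𝔤) (h : Sesq 𝔤), sharp_mem h h⟩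

/-- `h` solves `∂ₜ h = h^#`, `h(0) = h₀` on the interval `[0, T)`, where `T ≤ +∞`. The space of
Hermitian forms has finite dimension; the derivative is taken entry by entry (one-sided at
`t = 0`). The values of `h` outside `[0, T)` are irrelevant. -/
def IsSolution (h₀ : Sym11 𝔤) (T : EReal) (h : ℝ → Sym11 𝔤) : Prop :=
  h 0 = h₀ ∧ ∀ t : ℝ, 0 ≤ t → (t : EReal) < T → ∀ ξ η : Module.Dual ℂ 𝔤,
    HasDerivWithinAt (fun s => (h s : Sesq 𝔤) ξ η) ((sharpSq (h t) : Sesq 𝔤) ξ η) (Set.Ici 0) t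

/-- `h` is the solution with `h(0) = h₀` on the maximal time interval `[0, T)`, `0 < T ≤ +∞`. -/
def IsMaximalSolution (h₀ : Sym11 𝔤) (T : EReal) (h : ℝ → Sym11 𝔤) : Prop :=
  0 < T ∧ IsSolution h₀ T h ∧ ∀ (T' : EReal) (k : ℝ → Sym11 𝔤), IsSolution h₀ T' k → T' ≤ T

end HermitianFlow

end

/-! A positive semidefinite form is a sum of squares `∑ vᵢ ⊗ v̄ᵢ`, and then `(h # h)(ξ, ξ̄) = ∑
|ξ[vᵢ, vⱼ]|²` (`quad_sharp_sum_tens`). Hence `#` preserves the semidefinite cone and is monotone on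
it, and a solution from a positive definite `h₀` stays above `h₀` and is nondecreasing
(`IsSolution.quad_initial_le`, `IsSolution.quad_mono`). Diagonal values control a semidefinite form,
so a finite maximal time forces some `h(t)(ξ, ξ̄)` to be unbounded, hence, by monotonicity, to tend
to infinity.

If `𝔤` is not solvable, its derived series stabilizes at a nonzero perfect ideal. For a basis `e` of
it, the brackets `[eᵢ, eⱼ]` span the ideal again, so `k = ∑ eᵢ ⊗ ēᵢ` satisfies `k ≤ A k # k`
(`exists_norm_sq_le_lie`). From `h ≥ s k` follows `∂ₜ h ≥ (s²/2A) k`: the lower bound doubles after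
time `2A/s` (`IsSolution.two_mul_le`). These times form a convergent geometric series, so no
solution is immortal.

If `𝔤` is solvable, one descends through ideals `I` from `𝔤` to `0`, bounding `h(t)` exponentially
on the annihilator of `I`. Lie's theorem on `I^*` gives a functional `ξ` with `ξ[x, y] = χ(x) ξ(y)`
for `y ∈ I` (`exists_dual_eigenvector`). Modulo products of functionals already bounded, `ξ ∘ [·,·]`
is `χ ∧ ξ`, and `h(t)(χ, χ̄)` does not grow because `χ` kills commutators. So `h(t)(ξ, ξ̄)` obeys a
linear differential inequality with exponential forcing (`IsSolution.expBounded_eigenvector`), and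
`I` can be replaced by `I ∩ ker ξ`. -/

noncomputable section

/-! ### Maximal solutions of autonomous ODEs with locally Lipschitz field -/

section ODE

open Set Metric

variable {E : Type*} [NormedAddCommGroup E] [NormedSpace ℝ E]

/-- `y` solves the autonomous equation `y' = F y`, `y 0 = y₀` on `[0, T)`. -/
def SolvesODE (F : E → E) (y₀ : E) (T : EReal) (y : ℝ → E) : Prop :=
  y 0 = y₀ ∧ ∀ t : ℝ, 0 ≤ t → (t : EReal) < T → HasDerivWithinAt y (F (y t)) (Ici 0) t

/-- A vector field that is Lipschitz on every ball. -/
def LipschitzOnBalls (F : E → E) : Prop :=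
  ∀ R : ℝ, ∃ K : NNReal, LipschitzOnWith K F (closedBall 0 R)

theorem SolvesODE.continuousOn {F : E → E} {y₀ : E} {T : EReal} {y : ℝ → E}
    (hy : SolvesODE F y₀ T y) {b : ℝ} (hb : (b : EReal) < T) : ContinuousOn y (Icc 0 b) :=
  fun t ht => ((hy.2 t ht.1 ((EReal.coe_le_coe_iff.2 ht.2).trans_lt hb)).continuousWithinAt).mono
    fun _ hs => hs.1

/-- Solutions with the same initial value agree. -/
theorem SolvesODE.eq {F : E → E} (hF : LipschitzOnBalls F) {y₀ : E} {T T' : EReal}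
    {y z : ℝ → E} (hy : SolvesODE F y₀ T y) (hz : SolvesODE F y₀ T' z) {t : ℝ} (ht : 0 ≤ t)
    (htT : (t : EReal) < T) (htT' : (t : EReal) < T') : y t = z t := by
  have cy := hy.continuousOn htT
  have cz := hz.continuousOn htT'
  obtain ⟨A, hA⟩ := (isCompact_Icc.image_of_continuousOn cy).isBounded.subset_closedBall 0
  obtain ⟨B, hB⟩ := (isCompact_Icc.image_of_continuousOn cz).isBounded.subset_closedBall 0
  obtain ⟨K, hK⟩ := hF (max A B)
  have lt_of {s : ℝ} {S : EReal} (hs : s ∈ Ico 0 t) (hS : (t : EReal) < S) : (s : EReal) < S :=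
    (EReal.coe_le_coe_iff.2 hs.2.le).trans_lt hS
  refine ODE_solution_unique_of_mem_Icc_right (v := fun _ => F)
    (s := fun _ => closedBall 0 (max A B)) (K := K) (a := 0) (b := t) (fun _ _ => hK) cy
    (fun s hs => (hy.2 s hs.1 (lt_of hs htT)).mono (Ici_subset_Ici.2 hs.1)) ?_ cz
    (fun s hs => (hz.2 s hs.1 (lt_of hs htT')).mono (Ici_subset_Ici.2 hs.1)) ?_
    (hy.1.trans hz.1.symm) ⟨ht, le_rfl⟩
  · exact fun s hs => closedBall_subset_closedBall (le_max_left _ _)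
      (hA (mem_image_of_mem _ (Ico_subset_Icc_self hs)))
  · exact fun s hs => closedBall_subset_closedBall (le_max_right _ _)
      (hB (mem_image_of_mem _ (Ico_subset_Icc_self hs)))

variable [CompleteSpace E]

/-- The time of existence is bounded below uniformly on balls. -/
theorem LipschitzOnBalls.exists_local_solution {F : E → E} (hF : LipschitzOnBalls F) (R : ℝ) :
    ∃ δ : ℝ, 0 < δ ∧ ∀ (t₀ : ℝ) (y₁ : E), ‖y₁‖ ≤ R → ∃ z : ℝ → E, z t₀ = y₁ ∧
      ∀ t ∈ Icc t₀ (t₀ + δ), HasDerivWithinAt z (F (z t)) (Icc t₀ (t₀ + δ)) t := by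
  -- The solution is confined to the unit ball around `y₁`, inside the ball of radius `R + 1`. There
  -- `L` bounds the field, and the time `1 / (L + 1)` keeps the displacement at most 1.
  obtain ⟨K, hK⟩ := hF (R + 1)
  rcases lt_or_ge R 0 with hR | hR
  · exact ⟨1, one_pos, fun t₀ y₁ h => absurd ((norm_nonneg y₁).trans h) (not_le.2 hR)⟩
  let L : NNReal := ⟨‖F 0‖ + K * (R + 1), by positivity⟩
  have hL : ∀ x : E, ‖x‖ ≤ R + 1 → ‖F x‖ ≤ L := by
    intro x hx
    have h1 := hK.norm_sub_le (x := x) (y := 0) (by simpa using hx) (by simp; linarith)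
    have h2 : ‖F x‖ ≤ ‖F x - F 0‖ + ‖F 0‖ := by simpa using norm_add_le (F x - F 0) (F 0)
    have h3 : (K : ℝ) * ‖x - 0‖ ≤ K * (R + 1) := by
      rw [sub_zero]; exact mul_le_mul_of_nonneg_left hx K.2
    change ‖F x‖ ≤ ‖F 0‖ + K * (R + 1)
    linarith
  have hL0 : 0 < (L : ℝ) + 1 := by positivity
  refine ⟨1 / (L + 1), by positivity, fun t₀ y₁ hy₁ => ?_⟩
  have hball : closedBall y₁ ((1 : NNReal) : ℝ) ⊆ closedBall (0 : E) (R + 1) := by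
    refine closedBall_subset_closedBall' ?_
    simp only [dist_zero_right, NNReal.coe_one]; linarith
  have hpl : IsPicardLindelof (fun _ => F) (tmin := t₀) (tmax := t₀ + 1 / (L + 1))
      ⟨t₀, le_rfl, by simp; positivity⟩ y₁ 1 0 L K := by
    refine .of_time_independent (fun x hx => hL x (by simpa using hball hx)) (hK.mono hball) ?_
    have : (L : ℝ) * (1 / (L + 1)) ≤ 1 := by
      rw [mul_one_div, div_le_one hL0]; linarith
    simpa [max_eq_left, hL0.le] using this
  exact hpl.exists_eq_forall_mem_Icc_hasDerivWithinAt₀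

/-- A solution on `[0, τ)` that stays in a ball extends past `τ`. -/
theorem SolvesODE.exists_extension {F : E → E} (hF : LipschitzOnBalls F) {y₀ : E} {τ : ℝ}
    (hτ : 0 < τ) {y : ℝ → E} (hy : SolvesODE F y₀ τ y) {R : ℝ}
    (hR : ∀ t, 0 ≤ t → t < τ → ‖y t‖ ≤ R) :
    ∃ (τ' : ℝ) (z : ℝ → E), τ < τ' ∧ SolvesODE F y₀ τ' z := by
  obtain ⟨δ, hδ, H⟩ := hF.exists_local_solution R
  -- Since `δ` depends only on `R`, restarting close enough to `τ` carries the solution past `τ`.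
  obtain ⟨s, hs0, hsτ, hsδ⟩ : ∃ s, 0 < s ∧ s < τ ∧ τ < s + δ :=
    ⟨max (τ / 2) (τ - δ / 2), lt_max_of_lt_left (by linarith),
      max_lt (by linarith) (by linarith), by
        have := le_max_right (τ / 2) (τ - δ / 2); linarith⟩
  obtain ⟨z, hzs, hz⟩ := H s (y s) (hR s hs0.le hsτ)
  let w : ℝ → E := fun t => if t ≤ s then y t else z t
  have wl : ∀ t, t ≤ s → w t = y t := fun t ht => if_pos ht
  have wr : ∀ t, s ≤ t → w t = z t := fun t ht => by
    rcases ht.eq_or_lt with rfl | h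
    · rw [wl _ le_rfl, hzs]
    · exact if_neg (not_le.2 h)
  refine ⟨s + δ, w, hsδ, (wl 0 hs0.le).trans hy.1, fun t ht htT => ?_⟩
  have htT : t < s + δ := EReal.coe_lt_coe_iff.1 htT
  have hyd : t ≤ s → HasDerivWithinAt w (F (w t)) (Icc 0 s) t := fun hts => by
    rw [wl t hts]
    exact ((hy.2 t ht (EReal.coe_lt_coe_iff.2 (hts.trans_lt hsτ))).mono
      Icc_subset_Ici_self).congr (fun r hr => wl r hr.2) (wl t hts)
  have hzd : s ≤ t → HasDerivWithinAt w (F (w t)) (Icc s (s + δ)) t := fun hts => by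
    rw [wr t hts]
    exact (hz t ⟨hts, htT.le⟩).congr (fun r hr => wr r hr.1) (wr t hts)
  rcases lt_trichotomy t s with h | rfl | h
  · refine (hyd h.le).mono_of_mem_nhdsWithin ?_
    rw [← Ici_inter_Iic]
    exact Filter.inter_mem self_mem_nhdsWithin (mem_nhdsWithin_of_mem_nhds (Iic_mem_nhds h))
  -- At the junction the left and right derivatives are both `F (w t)`.
  · refine ((hyd le_rfl).union (hzd le_rfl)).mono_of_mem_nhdsWithin ?_
    rw [Icc_union_Icc_eq_Icc ht htT.le, ← Ici_inter_Iic]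
    exact Filter.inter_mem self_mem_nhdsWithin (mem_nhdsWithin_of_mem_nhds (Iic_mem_nhds htT))
  · exact (hzd h.le).mono_of_mem_nhdsWithin
      (mem_nhdsWithin_of_mem_nhds (Icc_mem_nhds h htT))

/-- Existence of the maximal solution. -/
theorem LipschitzOnBalls.exists_maximal {F : E → E} (hF : LipschitzOnBalls F) (y₀ : E) :
    ∃ (T : EReal) (y : ℝ → E), 0 < T ∧ SolvesODE F y₀ T y ∧
      ∀ (T' : EReal) (z : ℝ → E), SolvesODE F y₀ T' z → T' ≤ T := by
  classical
  let T : EReal := sSup {T' | ∃ z, SolvesODE F y₀ T' z}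
  have hmax : ∀ (T' : EReal) (z : ℝ → E), SolvesODE F y₀ T' z → T' ≤ T :=
    fun T' z hz => le_sSup ⟨z, hz⟩
  have hpos : 0 < T := by
    obtain ⟨δ, hδ, H⟩ := hF.exists_local_solution ‖y₀‖
    obtain ⟨z, hz0, hz⟩ := H 0 y₀ le_rfl
    rw [zero_add] at hz
    refine (EReal.coe_pos.2 hδ).trans_le (hmax δ z ⟨hz0, fun t ht htδ => ?_⟩)
    have htδ : t < δ := EReal.coe_lt_coe_iff.1 htδ
    refine (hz t ⟨ht, htδ.le⟩).mono_of_mem_nhdsWithin ?_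
    rw [← Ici_inter_Iic]
    exact Filter.inter_mem self_mem_nhdsWithin (mem_nhdsWithin_of_mem_nhds (Iic_mem_nhds htδ))
  have hex : ∀ t : ℝ, (t : EReal) < T →
      ∃ (T' : EReal) (z : ℝ → E), SolvesODE F y₀ T' z ∧ (t : EReal) < T' := fun t ht => by
    obtain ⟨T', ⟨z, hz⟩, h⟩ := lt_sSup_iff.1 ht
    exact ⟨T', z, hz, h⟩
  -- A different solution may be chosen for each `t`; by uniqueness the choice does not affect the
  -- value.
  let y : ℝ → E := fun t => if h : (t : EReal) < T then (hex t h).choose_spec.choose t else 0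
  have hy : ∀ (T' : EReal) (z : ℝ → E), SolvesODE F y₀ T' z → ∀ t : ℝ, 0 ≤ t →
      (t : EReal) < T' → y t = z t := fun T' z hz t ht htT' => by
    have h := htT'.trans_le (hmax T' z hz)
    obtain ⟨h1, h2⟩ := (hex t h).choose_spec.choose_spec
    simp only [y, dif_pos h]
    exact h1.eq hF hz ht h2 htT'
  refine ⟨T, y, hpos, ⟨?_, fun t ht htT => ?_⟩, hmax⟩
  · obtain ⟨T', z, hz, h⟩ := hex 0 hpos
    exact (hy T' z hz 0 le_rfl h).trans hz.1
  · obtain ⟨T', z, hz, h⟩ := hex t htT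
    rw [hy T' z hz t ht h]
    refine (hz.2 t ht h).congr_of_eventuallyEq_of_mem ?_ ht
    have hopen : {s : ℝ | (s : EReal) < T'} ∈ 𝓝 t :=
      (isOpen_Iio.preimage continuous_coe_real_ereal).mem_nhds h
    filter_upwards [self_mem_nhdsWithin, mem_nhdsWithin_of_mem_nhds hopen] with s hs hs'
    exact hy T' z hz s hs hs'

end ODE

namespace HermitianFlow

/-! ### Semidefinite Hermitian forms as sums of squares -/

section Forms

variable {𝔤 : Type*} [LieRing 𝔤] [LieAlgebra ℂ 𝔤]

/-- The real number `h(ξ, ξ̄)`. -/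
def quad (h : Sesq 𝔤) (ξ : Module.Dual ℂ 𝔤) : ℝ := (h ξ ξ).re

/-- Positive semidefinite Hermitian forms. -/
def IsNonneg (h : Sym11 𝔤) : Prop := ∀ ξ, 0 ≤ quad (h : Sesq 𝔤) ξ

theorem IsPos.isNonneg {h : Sym11 𝔤} (hh : IsPos h) : IsNonneg h := fun ξ => by
  rcases eq_or_ne ξ 0 with rfl | hξ
  · simp [quad]
  · exact (hh ξ hξ).le

@[simp] theorem quad_add (h k : Sesq 𝔤) (ξ : Module.Dual ℂ 𝔤) :
    quad (h + k) ξ = quad h ξ + quad k ξ := by simp [quad]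

@[simp] theorem quad_sub (h k : Sesq 𝔤) (ξ : Module.Dual ℂ 𝔤) :
    quad (h - k) ξ = quad h ξ - quad k ξ := by simp [quad]

@[simp] theorem quad_smul (c : ℝ) (h : Sesq 𝔤) (ξ : Module.Dual ℂ 𝔤) :
    quad (c • h) ξ = c * quad h ξ := by simp [quad]

theorem quad_sum {ι : Type*} (s : Finset ι) (f : ι → Sesq 𝔤) (ξ : Module.Dual ℂ 𝔤) :
    quad (∑ i ∈ s, f i) ξ = ∑ i ∈ s, quad (f i) ξ := by simp [quad, LinearMap.sum_apply]

theorem quad_tens_self (v : 𝔤) (ξ : Module.Dual ℂ 𝔤) : quad (tens v v) ξ = ‖ξ v‖ ^ 2 := by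
  rw [quad, tens_apply, Complex.mul_conj, Complex.ofReal_re, Complex.normSq_eq_norm_sq]

theorem tens_sum_left {ι : Type*} (s : Finset ι) (c : ι → ℂ) (f : ι → 𝔤) (w : 𝔤) :
    tens (∑ i ∈ s, c i • f i) w = ∑ i ∈ s, c i • tens (f i) w := by
  ext ξ η
  simp [LinearMap.sum_apply, Finset.sum_mul, mul_assoc]

theorem tens_sum_right {ι : Type*} (s : Finset ι) (c : ι → ℂ) (v : 𝔤) (f : ι → 𝔤) :
    tens v (∑ i ∈ s, c i • f i) = ∑ i ∈ s, conj (c i) • tens v (f i) := by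
  ext ξ η
  simp [LinearMap.sum_apply, Finset.mul_sum, mul_left_comm]

theorem norm_sum_sq_le {ι : Type*} (s : Finset ι) (f : ι → ℂ) :
    ‖∑ i ∈ s, f i‖ ^ 2 ≤ s.card * ∑ i ∈ s, ‖f i‖ ^ 2 :=
  (pow_le_pow_left₀ (norm_nonneg _) (norm_sum_le _ _) 2).trans sq_sum_le_card_mul_sum_sq

/-- Cauchy–Schwarz on a linear combination giving `e`. This turns spanning statements into
inequalities between sums of squares. -/
theorem exists_norm_sq_apply_le_of_mem_span {ι : Type*} [Fintype ι] {v : ι → 𝔤} {e : 𝔤}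
    (he : e ∈ Submodule.span ℂ (Set.range v)) :
    ∃ A : ℝ, 0 ≤ A ∧ ∀ ξ : Module.Dual ℂ 𝔤, ‖ξ e‖ ^ 2 ≤ A * ∑ i, ‖ξ (v i)‖ ^ 2 := by
  obtain ⟨c, rfl⟩ := (Submodule.mem_span_range_iff_exists_fun ℂ).1 he
  refine ⟨∑ i, ‖c i‖ ^ 2, by positivity, fun ξ => ?_⟩
  simp only [map_sum, map_smul, smul_eq_mul]
  calc ‖∑ i, c i * ξ (v i)‖ ^ 2 ≤ (∑ i, ‖c i‖ * ‖ξ (v i)‖) ^ 2 := by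
        refine pow_le_pow_left₀ (norm_nonneg _) ((norm_sum_le _ _).trans_eq ?_) 2
        simp only [norm_mul]
    _ ≤ _ := Finset.sum_mul_sq_le_sq_mul_sq _ _ _

theorem apply_eq_sum_sum {ι : Type*} [Fintype ι] (b : Module.Basis ι ℂ 𝔤) (h : Sesq 𝔤)
    (ξ η : Module.Dual ℂ 𝔤) :
    h ξ η = ∑ i, ∑ j, h (b.coord i) (b.coord j) * (ξ (b i) * conj (η (b j))) := by
  conv_lhs => rw [sesq_eq_sum b h]
  simp [LinearMap.sum_apply]

variable [FiniteDimensional ℂ 𝔤]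

open scoped ComplexOrder in
/-- A positive semidefinite form is a sum of squares `v ⊗ v̄`. -/
theorem IsNonneg.exists_eq_sum_tens {h : Sym11 𝔤} (hh : IsNonneg h) :
    ∃ v : Fin (Module.finrank ℂ 𝔤) → 𝔤, (h : Sesq 𝔤) = ∑ i, tens (v i) (v i) := by
  classical
  let b := Module.finBasis ℂ 𝔤
  -- The indices are swapped because the form is conjugate-linear in its second argument; with this
  -- order `x* M x` is the form evaluated at `∑ xⱼ bⱼ*`.
  let M : Matrix (Fin (Module.finrank ℂ 𝔤)) (Fin (Module.finrank ℂ 𝔤)) ℂ :=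
    Matrix.of fun i j => (h : Sesq 𝔤) (b.coord j) (b.coord i)
  have hM : M.PosSemidef := by
    refine .of_dotProduct_mulVec_nonneg ?_ fun x => ?_
    · ext i j
      exact (h.2 (b.coord j) (b.coord i)).symm
    · have hx : star x ⬝ᵥ (M.mulVec x) =
          (h : Sesq 𝔤) (∑ j, x j • b.coord j) (∑ j, x j • b.coord j) := by
        simp only [dotProduct, Matrix.mulVec, map_sum, map_smul, map_smulₛₗ,
          LinearMap.sum_apply, LinearMap.smul_apply, smul_eq_mul, Finset.mul_sum, M,
          Matrix.of_apply, Pi.star_apply, RCLike.star_def]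
        refine Finset.sum_congr rfl fun i _ => Finset.sum_congr rfl fun j _ => ?_
        ring
      rw [hx, Complex.nonneg_iff]
      refine ⟨hh _, ?_⟩
      have := congrArg Complex.im (h.2 (∑ j, x j • b.coord j) (∑ j, x j • b.coord j))
      rw [Complex.conj_im] at this
      linarith
  obtain ⟨B, hB⟩ : ∃ B : Matrix _ _ ℂ, M = star B * B := by
    open scoped MatrixOrder Matrix.Norms.L2Operator in
    exact CStarAlgebra.nonneg_iff_eq_star_mul_self.1 (Matrix.nonneg_iff_posSemidef.2 hM)
  refine ⟨fun k => ∑ j, B k j • b j, ?_⟩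
  have key : ∀ i j, (h : Sesq 𝔤) (b.coord i) (b.coord j) = ∑ k, conj (B k j) * B k i := by
    intro i j
    have := congrFun (congrFun hB j) i
    simpa [M, Matrix.mul_apply, Matrix.star_apply] using this
  conv_lhs => rw [sesq_eq_sum b (h : Sesq 𝔤)]
  simp only [key, tens_sum_left, tens_sum_right, Finset.sum_smul, Finset.smul_sum, smul_smul]
  calc _ = ∑ i, ∑ k, ∑ j, (conj (B k j) * B k i) • tens (b i) (b j) :=
        Finset.sum_congr rfl fun i _ => Finset.sum_comm
    _ = ∑ k, ∑ i, ∑ j, (conj (B k j) * B k i) • tens (b i) (b j) := Finset.sum_comm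
    _ = _ := by
        refine Finset.sum_congr rfl fun k _ => Finset.sum_comm.trans ?_
        simp only [mul_comm]

/-- On squares, `(v ⊗ v̄) # (w ⊗ w̄)` is again the square of `[v, w]`. All positivity and growth
estimates for `#` rest on this. -/
theorem quad_sharp_sum_tens {ι κ : Type*} [Fintype ι] [Fintype κ] (v : ι → 𝔤) (w : κ → 𝔤)
    (ξ : Module.Dual ℂ 𝔤) :
    quad (sharp (∑ i, tens (v i) (v i)) (∑ j, tens (w j) (w j))) ξ =
      ∑ i, ∑ j, ‖ξ ⁅v i, w j⁆‖ ^ 2 := by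
  simp only [map_sum, LinearMap.sum_apply, quad_sum, sharp_tens, quad_tens_self]
  exact Finset.sum_comm

theorem quad_sharp_nonneg {h k : Sym11 𝔤} (hh : IsNonneg h) (hk : IsNonneg k)
    (ξ : Module.Dual ℂ 𝔤) : 0 ≤ quad (sharp (h : Sesq 𝔤) (k : Sesq 𝔤)) ξ := by
  obtain ⟨v, hv⟩ := hh.exists_eq_sum_tens
  obtain ⟨w, hw⟩ := hk.exists_eq_sum_tens
  rw [hv, hw, quad_sharp_sum_tens]
  positivity

/-- Monotonicity of `h ↦ h # h` on the positive semidefinite cone. -/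
theorem quad_sharp_self_mono {h k : Sym11 𝔤} (hk : IsNonneg k) (hhk : IsNonneg (h - k))
    (ξ : Module.Dual ℂ 𝔤) :
    quad (sharp (k : Sesq 𝔤) (k : Sesq 𝔤)) ξ ≤ quad (sharp (h : Sesq 𝔤) (h : Sesq 𝔤)) ξ := by
  have hh : IsNonneg h := fun η => by
    have h1 := hk η
    have h2 := hhk η
    simp only [Submodule.coe_sub, quad_sub] at h2
    linarith
  -- `h # h - k # k = (h - k) # h + k # (h - k)`, a sum of two nonnegative terms.
  have h1 := quad_sharp_nonneg hhk hh ξ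
  have h2 := quad_sharp_nonneg hk hhk ξ
  simp only [Submodule.coe_sub, map_sub, LinearMap.sub_apply, quad_sub] at h1 h2
  linarith

@[simp] theorem quad_sharpSq (h : Sym11 𝔤) (ξ : Module.Dual ℂ 𝔤) :
    quad (sharpSq h : Sesq 𝔤) ξ = 1 / 2 * quad (sharp (h : Sesq 𝔤) (h : Sesq 𝔤)) ξ :=
  quad_smul _ _ _

/-- If `ξ ∘ [·,·] = ∑ αₐ ⊗ βₐ`, then `(h # h)(ξ, ξ̄)` is controlled by `h` on the `αₐ`, `βₐ`. -/
theorem quad_sharp_self_le {h : Sym11 𝔤} (hh : IsNonneg h) {ι : Type*} [Fintype ι]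
    (α β : ι → Module.Dual ℂ 𝔤) (ξ : Module.Dual ℂ 𝔤)
    (hξ : ∀ x y, ξ ⁅x, y⁆ = ∑ a, α a x * β a y) :
    quad (sharp (h : Sesq 𝔤) (h : Sesq 𝔤)) ξ ≤
      Fintype.card ι * ∑ a, quad (h : Sesq 𝔤) (α a) * quad (h : Sesq 𝔤) (β a) := by
  obtain ⟨v, hv⟩ := hh.exists_eq_sum_tens
  rw [hv, quad_sharp_sum_tens]
  simp only [quad_sum, quad_tens_self, hξ]
  calc ∑ i, ∑ j, ‖∑ a, α a (v i) * β a (v j)‖ ^ 2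
      ≤ ∑ i, ∑ j, (Fintype.card ι : ℝ) * ∑ a, ‖α a (v i) * β a (v j)‖ ^ 2 :=
        Finset.sum_le_sum fun i _ => Finset.sum_le_sum fun j _ => norm_sum_sq_le _ _
    _ = Fintype.card ι * ∑ a, ∑ i, ∑ j, ‖α a (v i)‖ ^ 2 * ‖β a (v j)‖ ^ 2 := by
        simp only [norm_mul, mul_pow, ← Finset.mul_sum]
        congr 1
        simp only [Finset.mul_sum]
        rw [Finset.sum_comm' (t' := Finset.univ) (s' := fun _ => Finset.univ) (by simp)]
        rw [Finset.sum_comm]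
        conv_rhs => rw [Finset.sum_comm]
        refine Finset.sum_congr rfl fun i _ => ?_
        exact Finset.sum_comm
    _ = _ := by simp only [Finset.sum_mul_sum]

/-- A positive definite form dominates any finite sum of squares. -/
theorem IsPos.exists_sum_norm_sq_le {h : Sym11 𝔤} (hh : IsPos h) {ι : Type*} [Fintype ι]
    (e : ι → 𝔤) : ∃ A : ℝ, 0 < A ∧ ∀ ξ : Module.Dual ℂ 𝔤,
      ∑ i, ‖ξ (e i)‖ ^ 2 ≤ A * quad (h : Sesq 𝔤) ξ := by
  obtain ⟨v, hv⟩ := hh.isNonneg.exists_eq_sum_tens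
  have hq : ∀ ξ, quad (h : Sesq 𝔤) ξ = ∑ i, ‖ξ (v i)‖ ^ 2 := fun ξ => by
    rw [hv]; simp only [quad_sum, quad_tens_self]
  -- A functional vanishing on all `v i` would have `h(ξ, ξ̄) = 0`, so definiteness makes the `v i`
  -- span.
  have hspan : Submodule.span ℂ (Set.range v) = ⊤ := by
    by_contra hne
    obtain ⟨ξ, hξ0, hξ⟩ := Submodule.exists_le_ker_of_lt_top _ (lt_top_iff_ne_top.2 hne)
    have hpos : 0 < quad (h : Sesq 𝔤) ξ := hh ξ hξ0
    rw [hq, Finset.sum_eq_zero] at hpos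
    · exact lt_irrefl _ hpos
    · intro i _
      have : ξ (v i) = 0 := hξ (Submodule.subset_span ⟨i, rfl⟩)
      simp [this]
  have hA := fun i => exists_norm_sq_apply_le_of_mem_span (v := v) (e := e i)
    (by rw [hspan]; trivial)
  choose A hA0 hA using hA
  refine ⟨∑ i, A i + 1, add_pos_of_nonneg_of_pos (Finset.sum_nonneg fun i _ => hA0 i) one_pos,
    fun ξ => ?_⟩
  calc ∑ i, ‖ξ (e i)‖ ^ 2 ≤ ∑ i, A i * quad (h : Sesq 𝔤) ξ :=
        Finset.sum_le_sum fun i _ => by rw [hq]; exact hA i ξ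
    _ ≤ _ := by rw [← Finset.sum_mul, add_mul, one_mul]; linarith [hh.isNonneg ξ]

/-- Cauchy–Schwarz, applied to each square of `h`. It passes bounds from finitely many functionals
to their span. -/
theorem IsNonneg.quad_sum_smul_le {h : Sym11 𝔤} (hh : IsNonneg h) {ι : Type*} [Fintype ι]
    (c : ι → ℂ) (ξ : ι → Module.Dual ℂ 𝔤) :
    quad (h : Sesq 𝔤) (∑ i, c i • ξ i) ≤
      Fintype.card ι * ∑ i, ‖c i‖ ^ 2 * quad (h : Sesq 𝔤) (ξ i) := by
  obtain ⟨v, hv⟩ := hh.exists_eq_sum_tens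
  rw [hv]
  simp only [quad_sum, quad_tens_self, LinearMap.sum_apply, LinearMap.smul_apply, smul_eq_mul]
  calc ∑ k, ‖∑ i, c i * ξ i (v k)‖ ^ 2
      ≤ ∑ k, (Fintype.card ι : ℝ) * ∑ i, ‖c i * ξ i (v k)‖ ^ 2 :=
        Finset.sum_le_sum fun k _ => norm_sum_sq_le _ _
    _ = _ := by
        rw [← Finset.mul_sum, Finset.sum_comm]
        simp only [norm_mul, mul_pow, Finset.mul_sum]

/-- For each square this is `|ab| ≤ |a|² + |b|²`. Thus diagonal bounds bound the whole form. -/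
theorem IsNonneg.norm_apply_le {h : Sym11 𝔤} (hh : IsNonneg h) (ξ η : Module.Dual ℂ 𝔤) :
    ‖(h : Sesq 𝔤) ξ η‖ ≤ quad (h : Sesq 𝔤) ξ + quad (h : Sesq 𝔤) η := by
  obtain ⟨v, hv⟩ := hh.exists_eq_sum_tens
  rw [hv]
  simp only [quad_sum, quad_tens_self, LinearMap.sum_apply, tens_apply]
  rw [← Finset.sum_add_distrib]
  refine (norm_sum_le _ _).trans (Finset.sum_le_sum fun i _ => ?_)
  rw [norm_mul, RCLike.norm_conj]
  nlinarith [sq_nonneg (‖ξ (v i)‖ - ‖η (v i)‖), sq_nonneg (‖ξ (v i)‖), sq_nonneg (‖η (v i)‖)]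

/-- Positive definiteness is an open condition. -/
theorem IsPos.exists_isNonneg_add {h : Sym11 𝔤} (hh : IsPos h) {ι : Type*} [Fintype ι]
    (b : Module.Basis ι ℂ 𝔤) : ∃ ε : ℝ, 0 < ε ∧ ∀ k : Sym11 𝔤,
      (∀ i j, ‖(k : Sesq 𝔤) (b.coord i) (b.coord j)‖ ≤ ε) → IsNonneg (h + k) := by
  obtain ⟨A, hA, H⟩ := hh.exists_sum_norm_sq_le b
  set n : ℝ := (Fintype.card ι : ℝ)
  have hn : 0 ≤ n := Nat.cast_nonneg _
  -- With entries at most `ε`, `|k(ξ, ξ̄)| ≤ ε n ∑ |ξ(bᵢ)|² ≤ ε n A h(ξ, ξ̄)`; `n + 1` avoids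
  -- division by zero when `n = 0`.
  refine ⟨1 / (A * (n + 1)), by positivity, fun k hk ξ => ?_⟩
  have h1 : |quad (k : Sesq 𝔤) ξ| ≤ 1 / (A * (n + 1)) * (n * ∑ i, ‖ξ (b i)‖ ^ 2) := by
    have hs : (∑ i, ‖ξ (b i)‖) ^ 2 ≤ n * ∑ i, ‖ξ (b i)‖ ^ 2 := sq_sum_le_card_mul_sum_sq
    calc |quad (k : Sesq 𝔤) ξ| ≤ ‖(k : Sesq 𝔤) ξ ξ‖ := Complex.abs_re_le_norm _
      _ ≤ ∑ i, ∑ j, 1 / (A * (n + 1)) * (‖ξ (b i)‖ * ‖ξ (b j)‖) := by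
          rw [apply_eq_sum_sum b]
          refine (norm_sum_le _ _).trans (Finset.sum_le_sum fun i _ =>
            (norm_sum_le _ _).trans (Finset.sum_le_sum fun j _ => ?_))
          rw [norm_mul, norm_mul, RCLike.norm_conj]
          exact mul_le_mul_of_nonneg_right (hk i j) (by positivity)
      _ = 1 / (A * (n + 1)) * (∑ i, ‖ξ (b i)‖) ^ 2 := by
          rw [sq, Finset.sum_mul_sum]; simp only [Finset.mul_sum]
      _ ≤ _ := mul_le_mul_of_nonneg_left hs (by positivity)
  have h2 : 1 / (A * (n + 1)) * (n * ∑ i, ‖ξ (b i)‖ ^ 2) ≤ quad (h : Sesq 𝔤) ξ := by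
    have hq := hh.isNonneg ξ
    have h3 : n * ∑ i, ‖ξ (b i)‖ ^ 2 ≤ n * (A * quad (h : Sesq 𝔤) ξ) :=
      mul_le_mul_of_nonneg_left (H ξ) hn
    rw [one_div, inv_mul_le_iff₀ (by positivity)]
    nlinarith [mul_nonneg hA.le hq]
  rw [Submodule.coe_add, quad_add]
  linarith [neg_abs_le (quad (k : Sesq 𝔤) ξ)]

end Forms

end HermitianFlow

/-! ### Differential inequalities and quadratic vector fields -/

section Calculus

open Set

/-- Interior points of `[a, b]` are positive, so there the derivative within `[0, ∞)` is two-sided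
and the mean value criterion applies. -/
theorem le_of_hasDerivWithinAt_Ici_nonneg {f f' : ℝ → ℝ} {a b : ℝ} (ha : 0 ≤ a) (hab : a ≤ b)
    (hf : ∀ t ∈ Icc a b, HasDerivWithinAt f (f' t) (Ici 0) t)
    (hf' : ∀ t ∈ Ioo a b, 0 ≤ f' t) : f a ≤ f b := by
  have hd : ∀ t ∈ Ioo a b, HasDerivAt f (f' t) t := fun t ht =>
    (hf t (Ioo_subset_Icc_self ht)).hasDerivAt (Ici_mem_nhds (ha.trans_lt ht.1))
  refine monotoneOn_of_deriv_nonneg (convex_Icc a b)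
    (fun t ht => (hf t ht).continuousWithinAt.mono fun s hs => ha.trans hs.1) ?_ ?_
    (left_mem_Icc.2 hab) (right_mem_Icc.2 hab) hab <;> rw [interior_Icc]
  · exact fun t ht => (hd t ht).differentiableAt.differentiableWithinAt
  · exact fun t ht => by rw [(hd t ht).deriv]; exact hf' t ht

/-- Linear differential inequalities with exponential forcing have exponentially bounded
solutions. -/
theorem exists_le_exp_of_deriv_le {f f' : ℝ → ℝ} {T : EReal} {a C K : ℝ} (hC : 0 ≤ C)
    (h0 : 0 ≤ f 0)
    (hf : ∀ t : ℝ, 0 ≤ t → (t : EReal) < T → HasDerivWithinAt f (f' t) (Ici 0) t)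
    (hf' : ∀ t : ℝ, 0 ≤ t → (t : EReal) < T → f' t ≤ a * f t + C * Real.exp (K * t)) :
    ∃ C' K' : ℝ, ∀ t : ℝ, 0 ≤ t → (t : EReal) < T → f t ≤ C' * Real.exp (K' * t) := by
  -- `L ≥ K` and `L - a ≥ 1` make the derivative of `(f 0 + C) e^{(L-a)s}` at least `C e^{(K-a)s}`,
  -- which bounds the derivative of `f(s) e^{-as}`.
  set L := max K (a + 1)
  refine ⟨f 0 + C, L, fun t ht htT => ?_⟩
  have hT : ∀ s ∈ Icc 0 t, (s : EReal) < T := fun s hs =>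
    (EReal.coe_le_coe_iff.2 hs.2).trans_lt htT
  have key := le_of_hasDerivWithinAt_Ici_nonneg le_rfl ht
    (f := fun s => (f 0 + C) * Real.exp ((L - a) * s) - f s * Real.exp (-a * s))
    (f' := fun s => (f 0 + C) * (Real.exp ((L - a) * s) * ((L - a) * 1)) -
      (f' s * Real.exp (-a * s) + f s * (Real.exp (-a * s) * (-a * 1)))) ?_ ?_
  · simp only [mul_zero, Real.exp_zero, mul_one] at key
    have h1 : f t * Real.exp (-a * t) ≤ (f 0 + C) * Real.exp ((L - a) * t) := by linarith
    have h2 := mul_le_mul_of_nonneg_right h1 (Real.exp_pos (a * t)).le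
    rw [mul_assoc, mul_assoc, ← Real.exp_add, ← Real.exp_add] at h2
    simpa [sub_mul] using h2
  · intro s hs
    refine HasDerivWithinAt.sub ?_ ?_
    · exact ((((hasDerivAt_id s).const_mul (L - a)).exp).const_mul (f 0 + C)).hasDerivWithinAt
    · exact (hf s hs.1 (hT s hs)).mul (((hasDerivAt_id s).const_mul (-a)).exp).hasDerivWithinAt
  · intro s hs
    have hs' := Ioo_subset_Icc_self hs
    have h1 := mul_le_mul_of_nonneg_right (hf' s hs'.1 (hT s hs')) (Real.exp_pos (-a * s)).le
    rw [add_mul, mul_assoc C, ← Real.exp_add] at h1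
    have h2 : Real.exp (K * s + -a * s) ≤ Real.exp ((L - a) * s) := by
      refine Real.exp_le_exp.2 ?_
      have := mul_le_mul_of_nonneg_right (le_max_left K (a + 1)) hs'.1
      change K * s + -a * s ≤ (max K (a + 1) - a) * s
      linarith
    have h3 : 1 ≤ L - a := by
      have := le_max_right K (a + 1)
      change 1 ≤ max K (a + 1) - a
      linarith
    have h4 : C * Real.exp (K * s + -a * s) ≤ (f 0 + C) * Real.exp ((L - a) * s) :=
      mul_le_mul (by linarith) h2 (Real.exp_pos _).le (by linarith)
    have h5 := mul_le_mul_of_nonneg_left h3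
      (mul_nonneg (add_nonneg h0 hC) (Real.exp_pos ((L - a) * s)).le)
    linarith

/-- Quadratic vector fields in finite dimension are Lipschitz on balls. -/
theorem lipschitzOnBalls_of_bilinear {E : Type*} [NormedAddCommGroup E] [NormedSpace ℝ E]
    [FiniteDimensional ℝ E] (B : E →ₗ[ℝ] E →ₗ[ℝ] E) : LipschitzOnBalls fun x => B x x := by
  intro R
  let B' := B.toContinuousBilinearMap
  refine ⟨(‖B'‖ * (2 * |R|)).toNNReal, LipschitzOnWith.of_dist_le_mul fun x hx y hy => ?_⟩
  rw [Real.coe_toNNReal _ (by positivity), dist_eq_norm, dist_eq_norm]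
  have hx' : ‖x‖ ≤ |R| := (by simpa using hx : ‖x‖ ≤ R).trans (le_abs_self R)
  have hy' : ‖y‖ ≤ |R| := (by simpa using hy : ‖y‖ ≤ R).trans (le_abs_self R)
  have h : B x x - B y y = B' (x - y) x + B' y (x - y) := by
    simp [B']
  rw [h]
  calc _ ≤ ‖B'‖ * ‖x - y‖ * ‖x‖ + ‖B'‖ * ‖y‖ * ‖x - y‖ :=
        (norm_add_le _ _).trans (add_le_add (B'.le_opNorm₂ _ _) (B'.le_opNorm₂ _ _))
    _ ≤ ‖B'‖ * ‖x - y‖ * |R| + ‖B'‖ * |R| * ‖x - y‖ := by gcongr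
    _ = _ := by ring

end Calculus

namespace HermitianFlow

/-! ### The flow on Hermitian forms: existence, positivity, monotonicity -/

section Flow

open Set

variable {𝔤 : Type*} [LieRing 𝔤] [LieAlgebra ℂ 𝔤]

/-- Evaluation of Hermitian forms, as a real linear map. -/
def evalAt (ξ η : Module.Dual ℂ 𝔤) : Sym11 𝔤 →ₗ[ℝ] ℂ where
  toFun h := (h : Sesq 𝔤) ξ η
  map_add' _ _ := rfl
  map_smul' _ _ := rfl

/-- The entries of a Hermitian form with respect to a basis. -/
def entries {ι : Type*} (b : Module.Basis ι ℂ 𝔤) : Sym11 𝔤 →ₗ[ℝ] ι → ι → ℂ where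
  toFun h i j := (h : Sesq 𝔤) (b.coord i) (b.coord j)
  map_add' _ _ := rfl
  map_smul' _ _ := rfl

theorem entries_injective {ι : Type*} [Fintype ι] (b : Module.Basis ι ℂ 𝔤) :
    Function.Injective (entries b) := fun h k hhk => by
  refine Subtype.ext ?_
  rw [sesq_eq_sum b (h : Sesq 𝔤), sesq_eq_sum b (k : Sesq 𝔤)]
  refine Finset.sum_congr rfl fun i _ => Finset.sum_congr rfl fun j _ => ?_
  rw [show (h : Sesq 𝔤) (b.coord i) (b.coord j) = (k : Sesq 𝔤) (b.coord i) (b.coord j) from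
    congrFun (congrFun hhk i) j]

variable [FiniteDimensional ℂ 𝔤]

instance : FiniteDimensional ℝ (Sym11 𝔤) :=
  Module.Finite.of_injective _ (entries_injective (Module.finBasis ℂ 𝔤))

instance : Module.Free ℝ (Sym11 𝔤) := by exact Module.Free.of_divisionRing ℝ (Sym11 𝔤)

variable (𝔤) in
/-- Real linear coordinates on the space of Hermitian forms. -/
def coords : Sym11 𝔤 ≃ₗ[ℝ] (Fin (Module.finrank ℝ (Sym11 𝔤)) → ℝ) :=
  (Module.finBasis ℝ (Sym11 𝔤)).equivFun

/-- The bilinear map with `sharpBilin h h = h^#`. -/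
def sharpBilin : Sym11 𝔤 →ₗ[ℝ] Sym11 𝔤 →ₗ[ℝ] Sym11 𝔤 :=
  LinearMap.mk₂ ℝ
    (fun h k => (1 / 2 : ℝ) • ⟨sharp (h : Sesq 𝔤) (k : Sesq 𝔤), sharp_mem h k⟩)
    (fun h h' k => by ext ξ η; simp)
    (fun c h k => by
      ext ξ η
      simp only [Submodule.coe_smul, LinearMap.smul_apply, ← Complex.coe_smul, map_smul,
        smul_eq_mul]
      ring)
    (fun h k k' => by ext ξ η; simp)
    (fun c h k => by
      ext ξ η
      simp only [Submodule.coe_smul, LinearMap.smul_apply, ← Complex.coe_smul, map_smul,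
        smul_eq_mul]
      ring)

variable (𝔤) in
/-- The vector field `h ↦ h^#` in coordinates. -/
def sharpField (y : Fin (Module.finrank ℝ (Sym11 𝔤)) → ℝ) :
    Fin (Module.finrank ℝ (Sym11 𝔤)) → ℝ :=
  coords 𝔤 (sharpSq ((coords 𝔤).symm y))

theorem lipschitzOnBalls_sharpField : LipschitzOnBalls (sharpField 𝔤) :=
  lipschitzOnBalls_of_bilinear
    ((sharpBilin (𝔤 := 𝔤).compl₁₂ (coords 𝔤).symm.toLinearMap (coords 𝔤).symm.toLinearMap).compr₂
      (coords 𝔤).toLinearMap)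

/-- The injective map `entries b` has a linear left inverse, continuous in finite dimension. So
bounds and derivatives of matrix entries transfer to real coordinates. -/
theorem exists_coords_eq_comp_entries {ι : Type*} [Fintype ι] (b : Module.Basis ι ℂ 𝔤) :
    ∃ L : (ι → ι → ℂ) →L[ℝ] (Fin (Module.finrank ℝ (Sym11 𝔤)) → ℝ),
      ∀ h, coords 𝔤 h = L (entries b h) := by
  obtain ⟨g, hg⟩ := (entries b).exists_leftInverse_of_injective
    (LinearMap.ker_eq_bot'.2 fun h hh => entries_injective b (hh.trans (map_zero _).symm))
  refine ⟨((coords 𝔤).toLinearMap ∘ₗ g).toContinuousLinearMap, fun h => ?_⟩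
  have : g (entries b h) = h := LinearMap.congr_fun hg h
  simp [this]

theorem hasDerivWithinAt_coords {h : ℝ → Sym11 𝔤} {k : Sym11 𝔤} {S : Set ℝ} {t : ℝ}
    (H : ∀ ξ η : Module.Dual ℂ 𝔤,
      HasDerivWithinAt (fun s => (h s : Sesq 𝔤) ξ η) ((k : Sesq 𝔤) ξ η) S t) :
    HasDerivWithinAt (fun s => coords 𝔤 (h s)) (coords 𝔤 k) S t := by
  let b := Module.finBasis ℂ 𝔤
  obtain ⟨L, hL⟩ := exists_coords_eq_comp_entries b
  have hd : HasDerivWithinAt (fun s => entries b (h s)) (entries b k) S t :=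
    hasDerivWithinAt_pi.2 fun i => hasDerivWithinAt_pi.2 fun j => H (b.coord i) (b.coord j)
  have hL' : (fun s => coords 𝔤 (h s)) = fun s => L (entries b (h s)) := funext fun s => hL (h s)
  rw [hL', hL]
  exact L.hasFDerivAt.comp_hasDerivWithinAt t hd

theorem hasDerivWithinAt_apply_of_coords {h : ℝ → Sym11 𝔤} {k : Sym11 𝔤} {S : Set ℝ} {t : ℝ}
    (H : HasDerivWithinAt (fun s => coords 𝔤 (h s)) (coords 𝔤 k) S t)
    (ξ η : Module.Dual ℂ 𝔤) :
    HasDerivWithinAt (fun s => (h s : Sesq 𝔤) ξ η) ((k : Sesq 𝔤) ξ η) S t := by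
  obtain ⟨φ, hφ⟩ : ∃ φ : (Fin (Module.finrank ℝ (Sym11 𝔤)) → ℝ) →L[ℝ] ℂ,
      ∀ k, φ (coords 𝔤 k) = (k : Sesq 𝔤) ξ η := by
    refine ⟨(evalAt ξ η ∘ₗ (coords 𝔤).symm.toLinearMap).toContinuousLinearMap, fun k => ?_⟩
    change evalAt ξ η ((coords 𝔤).symm (coords 𝔤 k)) = _
    rw [LinearEquiv.symm_apply_apply]; rfl
  simp only [← hφ]
  exact φ.hasFDerivAt.comp_hasDerivWithinAt t H

theorem sharpField_coords (h : Sym11 𝔤) : sharpField 𝔤 (coords 𝔤 h) = coords 𝔤 (sharpSq h) := by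
  rw [sharpField, LinearEquiv.symm_apply_apply]

/-- The dictionary between the entrywise equation on forms and an ODE in a normed space, to which
the general theory applies. -/
theorem isSolution_iff_solvesODE {h₀ : Sym11 𝔤} {T : EReal} {h : ℝ → Sym11 𝔤} :
    IsSolution h₀ T h ↔
      SolvesODE (sharpField 𝔤) (coords 𝔤 h₀) T (fun t => coords 𝔤 (h t)) := by
  simp only [IsSolution, SolvesODE, sharpField_coords]
  exact and_congr (coords 𝔤).injective.eq_iff.symm
    (forall_congr' fun t => forall_congr' fun ht => forall_congr' fun htT =>
      ⟨hasDerivWithinAt_coords, hasDerivWithinAt_apply_of_coords⟩)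

theorem exists_isMaximalSolution (h₀ : Sym11 𝔤) :
    ∃ (T : EReal) (h : ℝ → Sym11 𝔤), IsMaximalSolution h₀ T h := by
  obtain ⟨T, y, hT, hy, hmax⟩ := lipschitzOnBalls_sharpField.exists_maximal (coords 𝔤 h₀)
  refine ⟨T, fun t => (coords 𝔤).symm (y t), hT, isSolution_iff_solvesODE.2 ?_,
    fun T' k hk => hmax T' _ (isSolution_iff_solvesODE.1 hk)⟩
  simpa using hy

theorem IsSolution.eq {h₀ : Sym11 𝔤} {T T' : EReal} {h k : ℝ → Sym11 𝔤}
    (hh : IsSolution h₀ T h) (hk : IsSolution h₀ T' k) {t : ℝ} (ht : 0 ≤ t)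
    (htT : (t : EReal) < T) (htT' : (t : EReal) < T') : h t = k t :=
  (coords 𝔤).injective ((isSolution_iff_solvesODE.1 hh).eq lipschitzOnBalls_sharpField
    (isSolution_iff_solvesODE.1 hk) ht htT htT')

theorem IsSolution.hasDerivWithinAt_quad {h₀ : Sym11 𝔤} {T : EReal} {h : ℝ → Sym11 𝔤}
    (hh : IsSolution h₀ T h) {t : ℝ} (ht : 0 ≤ t) (htT : (t : EReal) < T)
    (ξ : Module.Dual ℂ 𝔤) :
    HasDerivWithinAt (fun s => quad (h s : Sesq 𝔤) ξ)
      (1 / 2 * quad (sharp (h t : Sesq 𝔤) (h t : Sesq 𝔤)) ξ) (Ici 0) t := by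
  rw [← quad_sharpSq]
  exact Complex.reCLM.hasFDerivAt.comp_hasDerivWithinAt t (hh.2 t ht htT ξ ξ)

/-- If `h` stays semidefinite, then it is nondecreasing. -/
theorem IsSolution.quad_le_of_isNonneg {h₀ : Sym11 𝔤} {T : EReal} {h : ℝ → Sym11 𝔤}
    (hh : IsSolution h₀ T h) {s t : ℝ} (hs : 0 ≤ s) (hst : s ≤ t) (htT : (t : EReal) < T)
    (hpos : ∀ r ∈ Ioo s t, IsNonneg (h r)) (ξ : Module.Dual ℂ 𝔤) :
    quad (h s : Sesq 𝔤) ξ ≤ quad (h t : Sesq 𝔤) ξ :=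
  le_of_hasDerivWithinAt_Ici_nonneg hs hst
    (fun _ hr => hh.hasDerivWithinAt_quad (hs.trans hr.1)
      ((EReal.coe_le_coe_iff.2 hr.2).trans_lt htT) ξ)
    fun r hr => mul_nonneg (by norm_num) (quad_sharp_nonneg (hpos r hr) (hpos r hr) ξ)

/-- Continuous induction on the times at which `h ≥ h₀`: this set is closed and contains 0. Where it
holds, `h` is positive definite, stays semidefinite for a short time, is therefore nondecreasing,
and the inequality persists. -/
theorem IsSolution.quad_initial_le {h₀ : Sym11 𝔤} (hpos : IsPos h₀) {T : EReal}
    {h : ℝ → Sym11 𝔤} (hh : IsSolution h₀ T h) {t : ℝ} (ht : 0 ≤ t) (htT : (t : EReal) < T)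
    (ξ : Module.Dual ℂ 𝔤) : quad (h₀ : Sesq 𝔤) ξ ≤ quad (h t : Sesq 𝔤) ξ := by
  let b := Module.finBasis ℂ 𝔤
  let S : Set ℝ := {s | ∀ ξ, quad (h₀ : Sesq 𝔤) ξ ≤ quad (h s : Sesq 𝔤) ξ}
  have hlt : ∀ s, s ≤ t → (s : EReal) < T := fun s hs => (EReal.coe_le_coe_iff.2 hs).trans_lt htT
  suffices H : Icc 0 t ⊆ S from H ⟨ht, le_rfl⟩ ξ
  refine IsClosed.Icc_subset_of_forall_mem_nhdsWithin ?_ ?_ ?_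
  · have : S ∩ Icc 0 t =
        ⋂ ξ, Icc 0 t ∩ (fun s => quad (h s : Sesq 𝔤) ξ) ⁻¹' Ici (quad (h₀ : Sesq 𝔤) ξ) := by
      ext s
      simp only [S, mem_inter_iff, mem_ofPred_eq, mem_iInter, mem_preimage, mem_Ici]
      exact ⟨fun hs ξ => ⟨hs.2, hs.1 ξ⟩, fun hs => ⟨fun ξ => (hs ξ).2, (hs 0).1⟩⟩
    rw [this]
    refine isClosed_iInter fun ξ => ContinuousOn.preimage_isClosed_of_isClosed ?_ isClosed_Icc
      isClosed_Ici
    exact fun s hs => (hh.hasDerivWithinAt_quad hs.1 (hlt s hs.2) ξ).continuousWithinAt.mono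
      fun r hr => hr.1
  · intro ξ
    rw [hh.1]
  · rintro x ⟨hxS, hx0, hxt⟩
    have hxpos : IsPos (h x) := fun ξ hξ => (hpos ξ hξ).trans_le (hxS ξ)
    obtain ⟨ε, hε, H⟩ := hxpos.exists_isNonneg_add b
    have hnear : ∀ᶠ s in 𝓝[>] x, IsNonneg (h s) := by
      have hij : ∀ i j, ∀ᶠ s in 𝓝[>] x,
          ‖((h s - h x : Sym11 𝔤) : Sesq 𝔤) (b.coord i) (b.coord j)‖ ≤ ε := fun i j => by
        have hc := ((hh.2 x hx0 (hlt x hxt.le) (b.coord i) (b.coord j)).continuousWithinAt).mono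
          (Ioi_subset_Ici hx0)
        have := hc.tendsto.eventually (Metric.closedBall_mem_nhds _ hε)
        filter_upwards [this] with s hs
        simpa [dist_eq_norm] using hs
      filter_upwards [Filter.eventually_all.2 fun i => Filter.eventually_all.2 (hij i)] with s hs
      have hsum : h x + (h s - h x) = h s := Subtype.ext (by simp)
      exact hsum ▸ H _ hs
    obtain ⟨u, hu, hsub⟩ := mem_nhdsGT_iff_exists_Ioo_subset.1 hnear
    filter_upwards [Ioo_mem_nhdsGT (lt_min hu hxt)] with s hs η
    refine (hxS η).trans (hh.quad_le_of_isNonneg hx0 hs.1.le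
      (hlt s (hs.2.le.trans (min_le_right _ _))) (fun r hr => hsub ⟨hr.1, ?_⟩) η)
    exact (hr.2.trans hs.2).trans_le (min_le_left _ _)

theorem IsSolution.isNonneg {h₀ : Sym11 𝔤} (hpos : IsPos h₀) {T : EReal}
    {h : ℝ → Sym11 𝔤} (hh : IsSolution h₀ T h) {t : ℝ} (ht : 0 ≤ t) (htT : (t : EReal) < T) :
    IsNonneg (h t) := fun ξ => (hpos.isNonneg ξ).trans (hh.quad_initial_le hpos ht htT ξ)

theorem IsSolution.quad_mono {h₀ : Sym11 𝔤} (hpos : IsPos h₀) {T : EReal}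
    {h : ℝ → Sym11 𝔤} (hh : IsSolution h₀ T h) {s t : ℝ} (hs : 0 ≤ s) (hst : s ≤ t)
    (htT : (t : EReal) < T) (ξ : Module.Dual ℂ 𝔤) :
    quad (h s : Sesq 𝔤) ξ ≤ quad (h t : Sesq 𝔤) ξ :=
  hh.quad_le_of_isNonneg hs hst htT (fun _ hr => hh.isNonneg hpos (hs.trans hr.1.le)
    ((EReal.coe_le_coe_iff.2 hr.2.le).trans_lt htT)) ξ

/-- At a finite maximal time some diagonal entry is unbounded. -/
theorem IsMaximalSolution.not_bounded {h₀ : Sym11 𝔤} (hpos : IsPos h₀) {τ : ℝ}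
    {h : ℝ → Sym11 𝔤} (hh : IsMaximalSolution h₀ τ h) {ι : Type*} [Fintype ι]
    (b : Module.Basis ι ℂ 𝔤) {R : ℝ} :
    ¬ ∀ i, ∀ t : ℝ, 0 ≤ t → t < τ → quad (h t : Sesq 𝔤) (b.coord i) ≤ R := by
  intro H
  obtain ⟨hτ, hsol, hmax⟩ := hh
  have hτ : 0 < τ := EReal.coe_pos.1 hτ
  obtain ⟨L, hL⟩ := exists_coords_eq_comp_entries b
  have hbound : ∀ t, 0 ≤ t → t < τ → ‖coords 𝔤 (h t)‖ ≤ ‖L‖ * |R + R| := fun t ht htτ => by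
    rw [hL]
    refine (L.le_opNorm _).trans (mul_le_mul_of_nonneg_left ?_ (norm_nonneg _))
    refine (pi_norm_le_iff_of_nonneg (abs_nonneg _)).2 fun i =>
      (pi_norm_le_iff_of_nonneg (abs_nonneg _)).2 fun j => ?_
    refine ((hsol.isNonneg hpos ht (EReal.coe_lt_coe_iff.2 htτ)).norm_apply_le _ _).trans
      (le_trans ?_ (le_abs_self _))
    exact add_le_add (H i t ht htτ) (H j t ht htτ)
  -- A solution bounded up to `τ` would extend past `τ`, against maximality.
  obtain ⟨τ', z, hττ', hz⟩ := (isSolution_iff_solvesODE.1 hsol).exists_extension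
    lipschitzOnBalls_sharpField hτ hbound
  have := hmax τ' (fun t => (coords 𝔤).symm (z t)) (isSolution_iff_solvesODE.2 (by simpa using hz))
  exact absurd (EReal.coe_le_coe_iff.1 this) (not_le.2 hττ')

end Flow

/-! ### Finite-time blow-up when `𝔤` is not solvable -/

section BlowUp

open Set

variable {𝔤 : Type*} [LieRing 𝔤] [LieAlgebra ℂ 𝔤]

/-- The Hermitian form `∑ eᵢ ⊗ ēᵢ`. -/
def sumSquares {n : ℕ} (e : Fin n → 𝔤) : Sym11 𝔤 :=
  ⟨∑ i, tens (e i) (e i), fun ξ η => by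
    simp [LinearMap.sum_apply, mul_comm]⟩

theorem quad_sumSquares {n : ℕ} (e : Fin n → 𝔤) (ξ : Module.Dual ℂ 𝔤) :
    quad (sumSquares e : Sesq 𝔤) ξ = ∑ i, ‖ξ (e i)‖ ^ 2 := by
  simp only [sumSquares, quad_sum, quad_tens_self]

variable [FiniteDimensional ℂ 𝔤]

/-- A Lie algebra that is not solvable contains a nonzero perfect ideal. -/
theorem exists_perfect_ideal (h𝔤 : ¬ LieAlgebra.IsSolvable 𝔤) :
    ∃ I : LieIdeal ℂ 𝔤, I ≠ ⊥ ∧ ⁅I, I⁆ = I := by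
  have wf : WellFounded ((· < ·) : LieIdeal ℂ 𝔤 → LieIdeal ℂ 𝔤 → Prop) :=
    (LieSubmodule.wellFoundedLT_of_isArtinian ℂ 𝔤 𝔤).wf
  -- A minimal term of the derived series equals the next one, so it is perfect; it is nonzero
  -- because `𝔤` is not solvable.
  obtain ⟨I, ⟨k, rfl⟩, hI⟩ := wf.has_min (range (LieAlgebra.derivedSeries ℂ 𝔤)) ⟨_, 0, rfl⟩
  refine ⟨LieAlgebra.derivedSeries ℂ 𝔤 k, fun h => h𝔤 (LieAlgebra.IsSolvable.mk h), ?_⟩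
  have hsucc : LieAlgebra.derivedSeries ℂ 𝔤 (k + 1) =
      ⁅LieAlgebra.derivedSeries ℂ 𝔤 k, LieAlgebra.derivedSeries ℂ 𝔤 k⁆ :=
    LieAlgebra.derivedSeriesOfIdeal_succ ℂ 𝔤 ⊤ k
  exact (LieSubmodule.lie_le_right _ _).eq_of_not_lt fun hlt => hI _ ⟨k + 1, rfl⟩ (hsucc ▸ hlt)

/-- In a Lie algebra that is not solvable, there is a nonzero finite family whose sum of squares
is controlled by the sum of squares of its brackets. -/
theorem exists_norm_sq_le_lie (h𝔤 : ¬ LieAlgebra.IsSolvable 𝔤) :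
    ∃ (n : ℕ) (e : Fin n → 𝔤), (∃ i, e i ≠ 0) ∧ ∃ A : ℝ, 0 < A ∧ ∀ ξ : Module.Dual ℂ 𝔤,
      ∑ i, ‖ξ (e i)‖ ^ 2 ≤ A * ∑ i, ∑ j, ‖ξ ⁅e i, e j⁆‖ ^ 2 := by
  obtain ⟨I, hI0, hI⟩ := exists_perfect_ideal h𝔤
  let b := Module.finBasis ℂ I.toSubmodule
  let e : Fin (Module.finrank ℂ I.toSubmodule) → 𝔤 := fun i => (b i : 𝔤)
  have hspan : Submodule.span ℂ (range e) = I.toSubmodule := by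
    have : range e = I.toSubmodule.subtype '' range b := by rw [← range_comp]; rfl
    rw [this, Submodule.span_image, b.span_eq, Submodule.map_top, Submodule.range_subtype]
  refine ⟨_, e, ?_, ?_⟩
  · by_contra! h
    apply hI0
    rw [← LieSubmodule.toSubmodule_eq_bot, ← hspan, Submodule.span_eq_bot]
    rintro _ ⟨i, rfl⟩
    exact h i
  · let p : Fin (Module.finrank ℂ I.toSubmodule) × Fin (Module.finrank ℂ I.toSubmodule) → 𝔤 :=
      fun q => ⁅e q.1, e q.2⁆
    -- Perfectness enters here: brackets of the basis `e` span `[I, I] = I`.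
    have hmem : ∀ i, e i ∈ Submodule.span ℂ (range p) := by
      have hle : I.toSubmodule ≤ Submodule.span ℂ (range p) := by
        conv_lhs => rw [← hI, LieSubmodule.lieIdeal_oper_eq_linear_span']
        refine Submodule.span_le.2 ?_
        rintro _ ⟨x, hx, y, hy, rfl⟩
        replace hx : x ∈ Submodule.span ℂ (range e) := by rw [hspan]; exact hx
        replace hy : y ∈ Submodule.span ℂ (range e) := by rw [hspan]; exact hy
        obtain ⟨c, rfl⟩ := (Submodule.mem_span_range_iff_exists_fun ℂ).1 hx
        obtain ⟨d, rfl⟩ := (Submodule.mem_span_range_iff_exists_fun ℂ).1 hy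
        simp only [sum_lie, lie_sum, smul_lie, lie_smul]
        exact Submodule.sum_mem _ fun i _ => Submodule.smul_mem _ _ <|
          Submodule.sum_mem _ fun j _ => Submodule.smul_mem _ _
            (Submodule.subset_span (mem_range_self (f := p) (_, _)))
      exact fun i => hle (b i).2
    choose A hA0 hA using fun i => exists_norm_sq_apply_le_of_mem_span (hmem i)
    refine ⟨∑ i, A i + 1, add_pos_of_nonneg_of_pos (Finset.sum_nonneg fun i _ => hA0 i) one_pos,
      fun ξ => ?_⟩
    have hp : ∑ q, ‖ξ (p q)‖ ^ 2 = ∑ i, ∑ j, ‖ξ ⁅e i, e j⁆‖ ^ 2 := Fintype.sum_prod_type _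
    have hp0 : 0 ≤ ∑ q, ‖ξ (p q)‖ ^ 2 := by positivity
    calc ∑ i, ‖ξ (e i)‖ ^ 2 ≤ ∑ i, A i * ∑ q, ‖ξ (p q)‖ ^ 2 :=
          Finset.sum_le_sum fun i _ => hA i ξ
      _ ≤ (∑ i, A i + 1) * ∑ q, ‖ξ (p q)‖ ^ 2 := by rw [← Finset.sum_mul]; linarith
      _ = _ := by rw [hp]

theorem quad_sharp_sumSquares {n : ℕ} (e : Fin n → 𝔤) (ξ : Module.Dual ℂ 𝔤) :
    quad (sharp (sumSquares e : Sesq 𝔤) (sumSquares e : Sesq 𝔤)) ξ =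
      ∑ i, ∑ j, ‖ξ ⁅e i, e j⁆‖ ^ 2 :=
  quad_sharp_sum_tens e e ξ

/-- If `k ≤ A k # k`, a lower bound `s k` for an immortal solution doubles after time
`2 A / s`. -/
theorem IsSolution.two_mul_le {h₀ : Sym11 𝔤} (hpos : IsPos h₀) {h : ℝ → Sym11 𝔤}
    (hh : IsSolution h₀ ⊤ h) {k : Sym11 𝔤} (hk : IsNonneg k) {A : ℝ} (hA : 0 < A)
    (hkA : ∀ ξ, quad (k : Sesq 𝔤) ξ ≤ A * quad (sharp (k : Sesq 𝔤) (k : Sesq 𝔤)) ξ)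
    {s t : ℝ} (hs : 0 < s) (ht : 0 ≤ t)
    (hst : ∀ ξ, s * quad (k : Sesq 𝔤) ξ ≤ quad (h t : Sesq 𝔤) ξ) (ξ : Module.Dual ℂ 𝔤) :
    2 * s * quad (k : Sesq 𝔤) ξ ≤ quad (h (t + 2 * A / s) : Sesq 𝔤) ξ := by
  -- From time `t` on `h ≥ s k`, hence `∂ₜ h ≥ ½ s² k # k ≥ (s²/2A) k`. So `c` bounds the rate
  -- below, and over time `2A/s` the gain is at least `s k`.
  set c := s ^ 2 / (2 * A) * quad (k : Sesq 𝔤) ξ with hc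
  have hsk : ∀ r, t ≤ r → IsNonneg (h r - s • k) := fun r hr η => by
    rw [Submodule.coe_sub, Submodule.coe_smul, quad_sub, quad_smul]
    linarith [hst η, hh.quad_mono hpos ht hr (EReal.coe_lt_top r) η]
  have hsk0 : IsNonneg (s • k) := fun η => by
    rw [Submodule.coe_smul, quad_smul]
    exact mul_nonneg hs.le (hk η)
  have hq : quad (sharp ((s • k : Sym11 𝔤) : Sesq 𝔤) ((s • k : Sym11 𝔤) : Sesq 𝔤)) ξ =
      s ^ 2 * quad (sharp (k : Sesq 𝔤) (k : Sesq 𝔤)) ξ := by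
    have : sharp ((s • k : Sym11 𝔤) : Sesq 𝔤) ((s • k : Sym11 𝔤) : Sesq 𝔤) =
        (s ^ 2) • sharp (k : Sesq 𝔤) (k : Sesq 𝔤) := by
      simp only [Submodule.coe_smul, ← Complex.coe_smul, map_smul, LinearMap.smul_apply, smul_smul]
      rw [sq, ← Complex.ofReal_mul, Complex.coe_smul]
    rw [this, quad_smul]
  have key := le_of_hasDerivWithinAt_Ici_nonneg ht
    (le_add_of_nonneg_right (by positivity : 0 ≤ 2 * A / s))
    (f := fun r => quad (h r : Sesq 𝔤) ξ - c * r)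
    (f' := fun r => 1 / 2 * quad (sharp (h r : Sesq 𝔤) (h r : Sesq 𝔤)) ξ - c * 1)
    (fun r hr => (hh.hasDerivWithinAt_quad (ht.trans hr.1) (EReal.coe_lt_top r) ξ).sub
      (((hasDerivAt_id r).const_mul c).hasDerivWithinAt)) fun r hr => by
        have h1 := quad_sharp_self_mono hsk0 (hsk r hr.1.le) ξ
        rw [hq] at h1
        have h2 : c ≤ 1 / 2 * (s ^ 2 * quad (sharp (k : Sesq 𝔤) (k : Sesq 𝔤)) ξ) := by
          rw [hc, div_mul_eq_mul_div, div_le_iff₀ (by positivity)]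
          nlinarith [mul_le_mul_of_nonneg_left (hkA ξ) (sq_nonneg s)]
        linarith
  have hcs : c * (2 * A / s) = s * quad (k : Sesq 𝔤) ξ := by
    rw [hc]; field_simp
  have := hst ξ
  linarith

/-- On a Lie algebra that is not solvable there are no immortal solutions. -/
theorem IsSolution.ne_top (h𝔤 : ¬ LieAlgebra.IsSolvable 𝔤) {h₀ : Sym11 𝔤} (hpos : IsPos h₀)
    {T : EReal} {h : ℝ → Sym11 𝔤} (hh : IsSolution h₀ T h) : T ≠ ⊤ := by
  rintro rfl
  obtain ⟨n, e, ⟨i₀, hi₀⟩, A, hA, hAe⟩ := exists_norm_sq_le_lie h𝔤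
  obtain ⟨B, hB, hBe⟩ := hpos.exists_sum_norm_sq_le e
  have hk : IsNonneg (sumSquares e) := fun ξ => by rw [quad_sumSquares]; positivity
  have hkA : ∀ ξ, quad (sumSquares e : Sesq 𝔤) ξ ≤
      A * quad (sharp (sumSquares e : Sesq 𝔤) (sumSquares e : Sesq 𝔤)) ξ := fun ξ => by
    rw [quad_sumSquares, quad_sharp_sumSquares]; exact hAe ξ
  -- The start `1 / B` comes from `k ≤ B h₀`; then the bound doubles at each step.
  let s : ℕ → ℝ := fun m => 2 ^ m / B
  have hs : ∀ m, 0 < s m := fun m => by positivity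
  -- The partial sums of the waiting times `2A / s m = 2AB / 2^m`. They stay below `4AB`, so by
  -- monotonicity `h (4AB)` would exceed every `s m k`.
  let t : ℕ → ℝ := fun m => 4 * A * B * (1 - 1 / 2 ^ m)
  have ht : ∀ m, 0 ≤ t m ∧ t m ≤ 4 * A * B := fun m => by
    have h1 : (1 : ℝ) / 2 ^ m ≤ 1 := by
      rw [div_le_one (by positivity)]; exact one_le_pow₀ (by norm_num)
    have h2 : (0 : ℝ) < 1 / 2 ^ m := by positivity
    have h3 : 0 < 4 * A * B := by positivity
    exact ⟨mul_nonneg h3.le (by linarith), mul_le_of_le_one_right h3.le (by linarith)⟩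
  have hlow : ∀ m ξ, s m * quad (sumSquares e : Sesq 𝔤) ξ ≤ quad (h (t m) : Sesq 𝔤) ξ := by
    intro m
    induction m with
    | zero =>
      intro ξ
      have : t 0 = 0 := by simp [t]
      rw [this, hh.1, quad_sumSquares]
      simp only [s, pow_zero, one_div]
      rw [inv_mul_le_iff₀ hB]
      exact hBe ξ
    | succ m ih =>
      intro ξ
      have h1 : t (m + 1) = t m + 2 * A / s m := by
        simp only [t, s, pow_succ]; field_simp; ring
      have h2 : s (m + 1) = 2 * s m := by simp only [s, pow_succ]; ring
      rw [h1, h2]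
      exact hh.two_mul_le hpos hk hA hkA (hs m) (ht m).1 ih ξ
  obtain ⟨ξ, hξ⟩ : ∃ ξ : Module.Dual ℂ 𝔤, ξ (e i₀) ≠ 0 := by
    by_contra! H
    exact hi₀ ((Module.forall_dual_apply_eq_zero_iff ℂ (e i₀)).1 H)
  have hq : 0 < quad (sumSquares e : Sesq 𝔤) ξ := by
    rw [quad_sumSquares]
    exact Finset.sum_pos' (fun i _ => by positivity) ⟨i₀, Finset.mem_univ _, by positivity⟩
  obtain ⟨m, hm⟩ := pow_unbounded_of_one_lt
    (B * quad (h (4 * A * B) : Sesq 𝔤) ξ / quad (sumSquares e : Sesq 𝔤) ξ) one_lt_two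
  have h1 := (hlow m ξ).trans (hh.quad_mono hpos (ht m).1 (ht m).2 (EReal.coe_lt_top _) ξ)
  rw [div_lt_iff₀ hq] at hm
  simp only [s] at h1
  rw [div_mul_eq_mul_div, div_le_iff₀ hB] at h1
  linarith

/-- At a finite maximal time some diagonal entry tends to infinity. -/
theorem IsMaximalSolution.exists_tendsto_atTop {h₀ : Sym11 𝔤} (hpos : IsPos h₀) {τ : ℝ}
    {h : ℝ → Sym11 𝔤} (hh : IsMaximalSolution h₀ τ h) :
    ∃ ξ : Module.Dual ℂ 𝔤,
      Filter.Tendsto (fun t => quad (h t : Sesq 𝔤) ξ) (𝓝[<] τ) Filter.atTop := by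
  by_contra! H
  let b := Module.finBasis ℂ 𝔤
  have hbd : ∀ i, ∃ R : ℝ, ∀ t : ℝ, 0 ≤ t → t < τ → quad (h t : Sesq 𝔤) (b.coord i) ≤ R := by
    intro i
    have := H (b.coord i)
    rw [Filter.tendsto_atTop] at this
    push Not at this
    obtain ⟨R, hR⟩ := this
    refine ⟨R, fun t ht htτ => ?_⟩
    -- By monotonicity, once a value exceeds `R` all later ones do, against `hR`.
    by_contra! hlt
    refine hR ?_
    filter_upwards [Ioo_mem_nhdsLT htτ] with r hr
    exact not_lt.2 <| hlt.le.trans (hh.2.1.quad_mono hpos ht hr.1.le (EReal.coe_lt_coe_iff.2 hr.2) _)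
  choose R hR using hbd
  refine hh.not_bounded hpos b (R := ∑ i, |R i|) fun i t ht htτ => (hR i t ht htτ).trans ?_
  exact (le_abs_self _).trans
    (Finset.single_le_sum (fun j _ => abs_nonneg (R j)) (Finset.mem_univ i))

end BlowUp

end HermitianFlow

/-! ### Closure properties of exponential bounds -/

section ExpBound

/-- Exponential upper bounds on `[0, T)`. -/
def ExpBounded (T : EReal) (f : ℝ → ℝ) : Prop :=
  ∃ C K : ℝ, 0 ≤ C ∧ 0 ≤ K ∧ ∀ t : ℝ, 0 ≤ t → (t : EReal) < T → f t ≤ C * Real.exp (K * t)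

variable {T : EReal} {f g : ℝ → ℝ}

theorem ExpBounded.of_le {C K : ℝ}
    (h : ∀ t : ℝ, 0 ≤ t → (t : EReal) < T → f t ≤ C * Real.exp (K * t)) : ExpBounded T f :=
  ⟨|C|, |K|, abs_nonneg _, abs_nonneg _, fun t ht htT => (h t ht htT).trans
    (mul_le_mul (le_abs_self C) (Real.exp_le_exp.2 (mul_le_mul_of_nonneg_right (le_abs_self K) ht))
      (Real.exp_pos _).le (abs_nonneg _))⟩

theorem ExpBounded.mono (hg : ExpBounded T g)
    (h : ∀ t : ℝ, 0 ≤ t → (t : EReal) < T → f t ≤ g t) : ExpBounded T f := by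
  obtain ⟨C, K, hC, hK, H⟩ := hg
  exact ⟨C, K, hC, hK, fun t ht htT => (h t ht htT).trans (H t ht htT)⟩

theorem ExpBounded.const (c : ℝ) : ExpBounded T fun _ => c :=
  .of_le (C := c) (K := 0) fun t _ _ => by simp

theorem ExpBounded.add (hf : ExpBounded T f) (hg : ExpBounded T g) :
    ExpBounded T fun t => f t + g t := by
  obtain ⟨C, K, hC, hK, H⟩ := hf
  obtain ⟨C', K', hC', hK', H'⟩ := hg
  refine ⟨C + C', max K K', add_nonneg hC hC', le_max_of_le_left hK, fun t ht htT => ?_⟩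
  have h1 := mul_le_mul_of_nonneg_left
    (Real.exp_le_exp.2 (mul_le_mul_of_nonneg_right (le_max_left K K') ht)) hC
  have h2 := mul_le_mul_of_nonneg_left
    (Real.exp_le_exp.2 (mul_le_mul_of_nonneg_right (le_max_right K K') ht)) hC'
  linarith [H t ht htT, H' t ht htT]

theorem ExpBounded.mul (hf : ExpBounded T f) (hg : ExpBounded T g)
    (hg0 : ∀ t : ℝ, 0 ≤ t → (t : EReal) < T → 0 ≤ g t) :
    ExpBounded T fun t => f t * g t := by
  obtain ⟨C, K, hC, hK, H⟩ := hf
  obtain ⟨C', K', hC', hK', H'⟩ := hg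
  refine ⟨C * C', K + K', mul_nonneg hC hC', add_nonneg hK hK', fun t ht htT => ?_⟩
  refine (mul_le_mul (H t ht htT) (H' t ht htT) (hg0 t ht htT) (by positivity)).trans_eq ?_
  rw [add_mul, Real.exp_add]; ring

theorem ExpBounded.const_mul {c : ℝ} (hc : 0 ≤ c) (hf : ExpBounded T f) :
    ExpBounded T fun t => c * f t := by
  obtain ⟨C, K, hC, hK, H⟩ := hf
  exact ⟨c * C, K, mul_nonneg hc hC, hK, fun t ht htT => by
    rw [mul_assoc]; exact mul_le_mul_of_nonneg_left (H t ht htT) hc⟩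

theorem ExpBounded.sum {ι : Type*} (s : Finset ι) {f : ι → ℝ → ℝ}
    (hf : ∀ i ∈ s, ExpBounded T (f i)) : ExpBounded T fun t => ∑ i ∈ s, f i t := by
  classical
  induction s using Finset.induction_on with
  | empty => simpa using ExpBounded.const (T := T) 0
  | insert a s ha ih =>
    simp only [Finset.sum_insert ha]
    exact (hf a (Finset.mem_insert_self a s)).add
      (ih fun i hi => hf i (Finset.mem_insert_of_mem hi))

end ExpBound

namespace HermitianFlow

/-! ### Exponential growth when `𝔤` is solvable -/

section Solvable

open Set

variable {𝔤 : Type*} [LieRing 𝔤] [LieAlgebra ℂ 𝔤]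

theorem quad_smul_right {h : Sym11 𝔤} (c : ℂ) (ξ : Module.Dual ℂ 𝔤) :
    quad (h : Sesq 𝔤) (c • ξ) = ‖c‖ ^ 2 * quad (h : Sesq 𝔤) ξ := by
  have : (h : Sesq 𝔤) (c • ξ) (c • ξ) = ((‖c‖ ^ 2 : ℝ) : ℂ) * (h : Sesq 𝔤) ξ ξ := by
    rw [LinearMap.map_smul, LinearMap.smul_apply, LinearMap.map_smulₛₗ, smul_eq_mul, smul_eq_mul,
      ← mul_assoc,      Complex.mul_conj, Complex.normSq_eq_norm_sq]
  rw [quad, this, Complex.re_ofReal_mul, quad]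

variable [FiniteDimensional ℂ 𝔤]

/-- Lie's theorem for the dual of an ideal: a nonzero ideal `I` of a solvable Lie algebra carries a
nonzero eigenfunctional `ξ`, and the eigencharacter vanishes on `I` and on commutators. -/
theorem exists_dual_eigenvector [LieAlgebra.IsSolvable 𝔤] {I : LieIdeal ℂ 𝔤} (hI : I ≠ ⊥) :
    ∃ (ξ χ : Module.Dual ℂ 𝔤) (e : 𝔤), e ∈ I ∧ ξ e = 1 ∧
      (∀ x : 𝔤, ∀ y ∈ I, ξ ⁅x, y⁆ = χ x * ξ y) ∧ (∀ x ∈ I, χ x = 0) ∧ ∀ x y : 𝔤, χ ⁅x, y⁆ = 0 := by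
  have : Nontrivial I := (LieSubmodule.nontrivial_iff_ne_bot ℂ 𝔤 𝔤).2 hI
  have : Nontrivial (I →ₗ[ℂ] ℂ) := inferInstanceAs (Nontrivial (Module.Dual ℂ I))
  obtain ⟨χ, hχ⟩ := LieModule.exists_nontrivial_weightSpace_of_isSolvable ℂ 𝔤 (I →ₗ[ℂ] ℂ)
  obtain ⟨⟨ψ, hψ⟩, hψ0⟩ := exists_ne (0 : LieModule.weightSpace (I →ₗ[ℂ] ℂ) χ)
  rw [LieModule.mem_weightSpace] at hψ
  have hψ0 : ψ ≠ 0 := fun h => hψ0 (Subtype.ext h)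
  obtain ⟨ξ₀, hξ₀⟩ := LinearMap.exists_extend (p := I.toSubmodule) ψ
  have hξψ : ∀ y (hy : y ∈ I), ξ₀ y = ψ ⟨y, hy⟩ := fun y hy => LinearMap.congr_fun hξ₀ ⟨y, hy⟩
  obtain ⟨e₀, he₀⟩ : ∃ e₀ : I, ψ e₀ ≠ 0 := by
    by_contra! H
    exact hψ0 (LinearMap.ext H)
  -- The dual action is `(x ψ)(y) = -ψ[x, y]`, so the eigencharacter is minus the weight.
  have heig : ∀ x : 𝔤, ∀ y ∈ I, ξ₀ ⁅x, y⁆ = (-χ) x * ξ₀ y := fun x y hy => by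
    have h1 := LinearMap.congr_fun (hψ x) ⟨y, hy⟩
    rw [Module.Dual.lie_apply] at h1
    rw [hξψ y hy, hξψ _ (lie_mem_right ℂ 𝔤 I x y hy), LinearMap.neg_apply, neg_mul]
    have h2 : -ψ ⟨⁅x, y⁆, lie_mem_right ℂ 𝔤 I x y hy⟩ = χ x * ψ ⟨y, hy⟩ := h1
    rw [← h2, neg_neg]
  set c := ξ₀ e₀ with hc
  have hc0 : c ≠ 0 := by rw [hc, hξψ _ e₀.2]; exact he₀
  have he1 : (c⁻¹ • (e₀ : 𝔤)) ∈ I := I.smul_mem _ e₀.2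
  have hξe : ξ₀ (c⁻¹ • (e₀ : 𝔤)) = 1 := by rw [map_smul, smul_eq_mul, ← hc, inv_mul_cancel₀ hc0]
  refine ⟨ξ₀, -χ, c⁻¹ • (e₀ : 𝔤), he1, hξe, heig, ?_, ?_⟩
  all_goals generalize c⁻¹ • (e₀ : 𝔤) = e at he1 hξe; generalize -χ = μ at heig
  -- For `x ∈ I` both entries of `[x, e]` lie in `I`, and antisymmetry gives `μ(x) = -μ(e) ξ(x)`.
  -- Taking `x = e` gives `μ(e) = 0`.
  · have key : ∀ x ∈ I, μ x = -(μ e * ξ₀ x) := fun x hx => by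
      have h1 := heig x e he1
      rw [hξe, mul_one, ← lie_skew, map_neg, heig e x hx] at h1
      exact h1.symm
    have h0 : μ e = 0 := by
      have := key e he1
      rw [hξe, mul_one] at this
      linear_combination this / 2
    intro x hx
    rw [key x hx, h0, zero_mul, neg_zero]
  · intro x y
    have h1 := heig ⁅x, y⁆ e he1
    rw [hξe, mul_one, lie_lie, map_sub, heig x _ (lie_mem_right ℂ 𝔤 I y e he1),
      heig y _ (lie_mem_right ℂ 𝔤 I x e he1), heig x e he1, heig y e he1, hξe] at h1
    rw [← h1]; ring

/-- A bilinear form vanishing when one argument is in `I` is a combination of products of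
functionals vanishing on `I`. -/
theorem exists_bilin_eq_sum (I : Submodule ℂ 𝔤) (B : 𝔤 →ₗ[ℂ] 𝔤 →ₗ[ℂ] ℂ)
    (hl : ∀ x ∈ I, ∀ y, B x y = 0) (hr : ∀ x, ∀ y ∈ I, B x y = 0) :
    ∃ (m : ℕ) (α : Fin m → Module.Dual ℂ 𝔤) (c : Fin m → Fin m → ℂ),
      (∀ i, ∀ x ∈ I, α i x = 0) ∧
      ∀ x y, B x y = ∑ p : Fin m × Fin m, (c p.1 p.2 • α p.1) x * α p.2 y := by
  let b := Module.finBasis ℂ (𝔤 ⧸ I)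
  choose e he using fun i => I.mkQ_surjective (b i)
  let α : Fin (Module.finrank ℂ (𝔤 ⧸ I)) → Module.Dual ℂ 𝔤 := fun i => b.coord i ∘ₗ I.mkQ
  -- The `α i` are pulled back from coordinates on `𝔤 ⧸ I`, and the `e i` lift its basis. Modulo `I`
  -- each vector is `∑ αᵢ(x) eᵢ`, and `B` ignores `I`.
  have hα : ∀ x, x - ∑ i, α i x • e i ∈ I := fun x => by
    rw [← Submodule.Quotient.mk_eq_zero I, ← Submodule.mkQ_apply, map_sub, map_sum]
    simp only [map_smul, he, α, LinearMap.comp_apply, Module.Basis.coord_apply]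
    rw [b.sum_repr, sub_self]
  refine ⟨_, α, fun i j => B (e i) (e j), fun i x hx => ?_, fun x y => ?_⟩
  · have : I.mkQ x = 0 := by simpa using hx
    simp [α, LinearMap.comp_apply, this]
  · have h1 : B x y = B (∑ i, α i x • e i) y := by
      have := hl _ (hα x) y
      rwa [map_sub, LinearMap.sub_apply, sub_eq_zero] at this
    have h2 : ∀ z, B z y = B z (∑ j, α j y • e j) := fun z => by
      have := hr z _ (hα y)
      rwa [map_sub, sub_eq_zero] at this
    rw [h1, h2, Fintype.sum_prod_type]
    simp only [map_sum, map_smul, LinearMap.sum_apply, LinearMap.smul_apply, smul_eq_mul,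
      Finset.mul_sum]
    rw [Finset.sum_comm]
    exact Finset.sum_congr rfl fun i _ => Finset.sum_congr rfl fun j _ => by ring

/-- Functionals vanishing on commutators are conserved, in particular do not grow. -/
theorem IsSolution.quad_le_of_forall_lie {h₀ : Sym11 𝔤} (hpos : IsPos h₀) {T : EReal}
    {h : ℝ → Sym11 𝔤} (hh : IsSolution h₀ T h) {χ : Module.Dual ℂ 𝔤}
    (hχ : ∀ x y : 𝔤, χ ⁅x, y⁆ = 0) {t : ℝ} (ht : 0 ≤ t) (htT : (t : EReal) < T) :
    quad (h t : Sesq 𝔤) χ ≤ quad (h₀ : Sesq 𝔤) χ := by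
  have key := le_of_hasDerivWithinAt_Ici_nonneg le_rfl ht
    (fun s hs => (hh.hasDerivWithinAt_quad hs.1
      ((EReal.coe_le_coe_iff.2 hs.2).trans_lt htT) χ).fun_neg) fun s hs => by
      -- `χ ∘ [·,·] = 0` is the empty sum of products, so the derivative is at most 0.
      have := quad_sharp_self_le (hh.isNonneg hpos hs.1.le
        ((EReal.coe_le_coe_iff.2 hs.2.le).trans_lt htT)) (ι := Empty) Empty.elim Empty.elim χ
        (by simpa using hχ)
      simp only [Finset.univ_eq_empty, Finset.sum_empty, mul_zero] at this
      linarith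
  rw [hh.1] at key
  linarith

/-- The inductive step: growth bounds pass from the annihilator of `I` to an eigenfunctional
on `I`. -/
theorem IsSolution.expBounded_eigenvector {h₀ : Sym11 𝔤} (hpos : IsPos h₀) {T : EReal}
    {h : ℝ → Sym11 𝔤} (hT : 0 < T) (hh : IsSolution h₀ T h) {I : LieIdeal ℂ 𝔤}
    (hI : ∀ η : Module.Dual ℂ 𝔤, (∀ x ∈ I, η x = 0) →
      ExpBounded T fun t => quad (h t : Sesq 𝔤) η)
    {ξ χ : Module.Dual ℂ 𝔤} (hξ : ∀ x : 𝔤, ∀ y ∈ I, ξ ⁅x, y⁆ = χ x * ξ y)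
    (hχI : ∀ x ∈ I, χ x = 0) (hχ : ∀ x y : 𝔤, χ ⁅x, y⁆ = 0) :
    ExpBounded T fun t => quad (h t : Sesq 𝔤) ξ := by
  -- Subtracting `χ ∧ ξ` from `ξ ∘ [·,·]` leaves a form vanishing as soon as one argument is in `I`;
  -- it therefore involves only functionals whose growth is already bounded.
  let B : 𝔤 →ₗ[ℂ] 𝔤 →ₗ[ℂ] ℂ := LinearMap.mk₂ ℂ (fun x y => ξ ⁅x, y⁆ - χ x * ξ y + ξ x * χ y)
    (fun x x' y => by simp only [add_lie, map_add]; ring)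
    (fun c x y => by simp only [smul_lie, map_smul, smul_eq_mul]; ring)
    (fun x y y' => by simp only [lie_add, map_add]; ring)
    (fun c x y => by simp only [lie_smul, map_smul, smul_eq_mul]; ring)
  have hB : ∀ x y, B x y = ξ ⁅x, y⁆ - χ x * ξ y + ξ x * χ y := fun _ _ => rfl
  obtain ⟨m, α, c, hα, hBα⟩ := exists_bilin_eq_sum I.toSubmodule B
    (fun x hx y => by
      rw [hB, ← lie_skew, map_neg, hξ y x hx, hχI x hx]; ring)
    (fun x y hy => by rw [hB, hξ x y hy, hχI y hy]; ring)
  let β : Bool ⊕ (Fin m × Fin m) → Module.Dual ℂ 𝔤 :=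
    Sum.elim (fun s => cond s χ (-ξ)) fun p => c p.1 p.2 • α p.1
  let γ : Bool ⊕ (Fin m × Fin m) → Module.Dual ℂ 𝔤 :=
    Sum.elim (fun s => cond s ξ χ) fun p => α p.2
  have hexp : ∀ x y : 𝔤, ξ ⁅x, y⁆ = ∑ a, β a x * γ a y := fun x y => by
    have h1 := hB x y
    rw [hBα] at h1
    simp only [β, γ, Fintype.sum_sum_type, Sum.elim_inl, Sum.elim_inr, Fintype.sum_bool, cond_true,
      cond_false]
    rw [h1, LinearMap.neg_apply]
    ring
  set N : ℝ := (Fintype.card (Bool ⊕ (Fin m × Fin m)) : ℝ)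
  have hN : 0 ≤ N := Nat.cast_nonneg _
  have hq0 : ∀ (η : Module.Dual ℂ 𝔤) (t : ℝ), 0 ≤ t → (t : EReal) < T →
      0 ≤ quad (h t : Sesq 𝔤) η := fun η t ht htT => hh.isNonneg hpos ht htT η
  have hα' : ∀ i, ExpBounded T fun t => quad (h t : Sesq 𝔤) (α i) := fun i => hI _ (hα i)
  obtain ⟨C, K, hC, -, hCK⟩ : ExpBounded T fun t => N * ∑ p : Fin m × Fin m,
      quad (h t : Sesq 𝔤) (c p.1 p.2 • α p.1) * quad (h t : Sesq 𝔤) (α p.2) := by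
    refine (ExpBounded.sum _ fun p _ => ?_).const_mul hN
    refine ExpBounded.mul ?_ (hα' _) (hq0 _)
    simp only [quad_smul_right]
    exact (hα' _).const_mul (by positivity)
  have hneg : ∀ t, quad (h t : Sesq 𝔤) (-ξ) = quad (h t : Sesq 𝔤) ξ := fun t => by simp [quad]
  -- Each of the two terms of `χ ∧ ξ` contributes `h(χ, χ̄) h(ξ, ξ̄) ≤ h₀(χ, χ̄) h(ξ, ξ̄)`. The
  -- quadratic inequality is thus linear in the unknown, with the constant coefficient `a`.
  obtain ⟨C', K', H⟩ := exists_le_exp_of_deriv_le (f := fun t => quad (h t : Sesq 𝔤) ξ)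
    (a := N * (2 * quad (h₀ : Sesq 𝔤) χ)) (C := C) (K := K) hC (hq0 ξ 0 le_rfl hT)
    (fun t ht htT => hh.hasDerivWithinAt_quad ht htT ξ) fun t ht htT => by
      have h1 : _ ≤ N * ∑ a, quad (h t : Sesq 𝔤) (β a) * quad (h t : Sesq 𝔤) (γ a) :=
        quad_sharp_self_le (hh.isNonneg hpos ht htT) β γ ξ hexp
      have h2 := hCK t ht htT
      beta_reduce at h2
      have h3 := quad_sharp_nonneg (hh.isNonneg hpos ht htT) (hh.isNonneg hpos ht htT) ξ
      have h4 := mul_le_mul_of_nonneg_right (hh.quad_le_of_forall_lie hpos hχ ht htT)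
        (hq0 ξ t ht htT)
      have h5 := mul_le_mul_of_nonneg_left h4 hN
      simp only [β, γ, Fintype.sum_sum_type, Sum.elim_inl, Sum.elim_inr, Fintype.sum_bool,
        cond_true, cond_false, hneg] at h1
      rw [mul_add] at h1
      linarith
  exact .of_le H

/-- On a solvable Lie algebra every entry of a solution has at most exponential growth. -/
theorem IsSolution.expBounded [LieAlgebra.IsSolvable 𝔤] {h₀ : Sym11 𝔤} (hpos : IsPos h₀)
    {T : EReal} {h : ℝ → Sym11 𝔤} (hT : 0 < T) (hh : IsSolution h₀ T h)
    (ξ : Module.Dual ℂ 𝔤) : ExpBounded T fun t => quad (h t : Sesq 𝔤) ξ := by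
  let P : Set (LieIdeal ℂ 𝔤) := {I | ∀ η : Module.Dual ℂ 𝔤, (∀ x ∈ I, η x = 0) →
    ExpBounded T fun t => quad (h t : Sesq 𝔤) η}
  have hne : (⊤ : LieIdeal ℂ 𝔤) ∈ P := fun η hη => by
    have : η = 0 := LinearMap.ext fun x => hη x (LieSubmodule.mem_top x)
    subst this
    simpa [quad] using ExpBounded.const (T := T) 0
  have wf : WellFounded ((· < ·) : LieIdeal ℂ 𝔤 → LieIdeal ℂ 𝔤 → Prop) :=
    (LieSubmodule.wellFoundedLT_of_isArtinian ℂ 𝔤 𝔤).wf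
  obtain ⟨I, hIP, hmin⟩ := wf.has_min P ⟨_, hne⟩
  rcases eq_or_ne I ⊥ with rfl | hI
  · exact hIP ξ fun x hx => by rw [(LieSubmodule.mem_bot x).1 hx, map_zero]
  obtain ⟨ζ, χ, e, heI, hζe, hζ, hχI, hχ⟩ := exists_dual_eigenvector hI
  have hζb := hh.expBounded_eigenvector hpos hT hIP hζ hχI hχ
  -- `I ∩ ker ζ` is an ideal because `ζ` is an eigenfunctional on `I`; it is smaller since `ζ e =
  -- 1`.
  let J : LieIdeal ℂ 𝔤 :=
    { I.toSubmodule ⊓ LinearMap.ker ζ with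
      lie_mem := fun {x y} hy => ⟨lie_mem_right ℂ 𝔤 I x y hy.1, by
        have h0 : ζ y = 0 := hy.2
        rw [SetLike.mem_coe, LinearMap.mem_ker, hζ x y hy.1, h0, mul_zero]⟩ }
  have hJ : ∀ y, y ∈ J ↔ y ∈ I ∧ ζ y = 0 := fun y => Iff.rfl
  refine absurd ?_ (hmin J fun η hη => ?_)
  · refine lt_of_le_of_ne (fun y hy => ((hJ y).1 hy).1) fun hJI => ?_
    have := ((hJ e).1 (hJI ▸ heI)).2
    rw [hζe] at this
    exact one_ne_zero this
  -- Since `I = J + ℂ e`, a functional `η` vanishing on `J` differs from `η(e) ζ` by one vanishing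
  -- on `I`.
  · have h1 : ∀ x ∈ I, (η - η e • ζ) x = 0 := fun x hx => by
      have hmem : x - ζ x • e ∈ J := by
        refine (hJ _).2 ⟨sub_mem hx (I.smul_mem _ heI), ?_⟩
        rw [map_sub, map_smul, hζe, smul_eq_mul, mul_one, sub_self]
      have := hη _ hmem
      rw [map_sub, map_smul, smul_eq_mul] at this
      rw [LinearMap.sub_apply, LinearMap.smul_apply, smul_eq_mul]
      linear_combination this
    refine (((hIP _ h1).add (hζb.const_mul (sq_nonneg ‖η e‖))).const_mul zero_le_two).mono
      fun t ht htT => ?_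
    have := (hh.isNonneg hpos ht htT).quad_sum_smul_le ![1, η e] ![η - η e • ζ, ζ]
    simpa [Fin.sum_univ_two] using this

/-- An exponential bound is uniform on a bounded interval, which a finite maximal time excludes. -/
theorem IsMaximalSolution.eq_top [LieAlgebra.IsSolvable 𝔤] {h₀ : Sym11 𝔤} (hpos : IsPos h₀)
    {T : EReal} {h : ℝ → Sym11 𝔤} (hh : IsMaximalSolution h₀ T h) : T = ⊤ := by
  induction T with
  | bot => exact absurd hh.1 (by simp)
  | top => rfl
  | coe τ =>
    exfalso
    let b := Module.finBasis ℂ 𝔤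
    choose C K hC hK H using fun i => hh.2.1.expBounded hpos hh.1 (b.coord i)
    refine hh.not_bounded hpos b (R := ∑ i, C i * Real.exp (K i * τ)) fun i t ht htτ => ?_
    refine (H i t ht (EReal.coe_lt_coe_iff.2 htτ)).trans (le_trans ?_ (Finset.single_le_sum
      (f := fun i => C i * Real.exp (K i * τ))
      (fun j _ => mul_nonneg (hC j) (Real.exp_pos _).le) (Finset.mem_univ i)))
    exact mul_le_mul_of_nonneg_left
      (Real.exp_le_exp.2 (mul_le_mul_of_nonneg_left htτ.le (hK i))) (hC i)

theorem IsSolution.exists_formLT [LieAlgebra.IsSolvable 𝔤] {h₀ : Sym11 𝔤} (hpos : IsPos h₀)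
    {h : ℝ → Sym11 𝔤} (hh : IsSolution h₀ ⊤ h) :
    ∃ C K : ℝ, ∀ t : ℝ, 0 ≤ t → FormLT (h t) ((C * Real.exp (K * t)) • h₀) := by
  let b := Module.finBasis ℂ 𝔤
  obtain ⟨A, hA, hAb⟩ := hpos.exists_sum_norm_sq_le b
  obtain ⟨C, K, hC, hK, H⟩ := ExpBounded.sum (T := ⊤) Finset.univ
    fun i _ => hh.expBounded hpos EReal.zero_lt_top (b.coord i)
  set n : ℝ := (Fintype.card (Fin (Module.finrank ℂ 𝔤)) : ℝ)
  have hn : 0 ≤ n := Nat.cast_nonneg _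
  -- The factor `n` comes from expanding `ξ` in the dual basis, `A` from comparing `∑ |ξ(bᵢ)|²` with
  -- `h₀`; the `+ 1` makes the inequality strict.
  refine ⟨n * C * A + 1, K, fun t ht ξ hξ => ?_⟩
  have hnn := hh.isNonneg hpos ht (EReal.coe_lt_top t)
  have hq : 0 < quad (h₀ : Sesq 𝔤) ξ := hpos ξ hξ
  have hexp := Real.exp_pos (K * t)
  have h1 : quad (h t : Sesq 𝔤) ξ ≤ n * ∑ i, ‖ξ (b i)‖ ^ 2 * quad (h t : Sesq 𝔤) (b.coord i) := by
    have := hnn.quad_sum_smul_le (fun i => ξ (b i)) fun i => b.coord i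
    rwa [b.sum_dual_apply_smul_coord ξ] at this
  have h2 : ∑ i, ‖ξ (b i)‖ ^ 2 * quad (h t : Sesq 𝔤) (b.coord i) ≤
      (A * quad (h₀ : Sesq 𝔤) ξ) * (C * Real.exp (K * t)) := by
    refine le_trans ?_ (mul_le_mul_of_nonneg_right (hAb ξ) (by positivity))
    rw [Finset.sum_mul]
    refine Finset.sum_le_sum fun i _ => mul_le_mul_of_nonneg_left ?_ (by positivity)
    exact (Finset.single_le_sum (f := fun i => quad (h t : Sesq 𝔤) (b.coord i))
      (fun j _ => hnn _) (Finset.mem_univ i)).trans (H t ht (EReal.coe_lt_top t))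
  have h3 := mul_le_mul_of_nonneg_left h2 hn
  change 0 < quad (((n * C * A + 1) * Real.exp (K * t)) • (h₀ : Sesq 𝔤) - (h t : Sesq 𝔤)) ξ
  rw [quad_sub, quad_smul]
  nlinarith [mul_pos hexp hq]

variable (𝔤) in
-- Needed so that the universal growth condition is not vacuous and yields the existential one.
theorem exists_isPos : ∃ h₀ : Sym11 𝔤, IsPos h₀ := by
  let b := Module.finBasis ℂ 𝔤
  refine ⟨sumSquares b, fun ξ hξ => ?_⟩
  change 0 < quad (sumSquares b : Sesq 𝔤) ξ
  rw [quad_sumSquares]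
  obtain ⟨i, hi⟩ : ∃ i, ξ (b i) ≠ 0 := by
    by_contra! H
    exact hξ (b.ext fun i => by simpa using H i)
  exact Finset.sum_pos' (fun i _ => by positivity) ⟨i, Finset.mem_univ _, by positivity⟩

end Solvable

end HermitianFlow

end

/-! ### The main theorem -/

theorem mainTheorem2 (𝔤 : Type*) [LieRing 𝔤] [LieAlgebra ℂ 𝔤] [FiniteDimensional ℂ 𝔤] :
    (∀ h₀ : HermitianFlow.Sym11 𝔤, HermitianFlow.IsPos h₀ →
      ∃ (T : EReal) (h : ℝ → HermitianFlow.Sym11 𝔤), HermitianFlow.IsMaximalSolution h₀ T h ∧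
        ∀ (T' : EReal) (k : ℝ → HermitianFlow.Sym11 𝔤), HermitianFlow.IsSolution h₀ T' k →
          ∀ t : ℝ, 0 ≤ t → (t : EReal) < T' → k t = h t) ∧
    List.TFAE [
      LieAlgebra.IsSolvable 𝔤,
      ∀ h₀ : HermitianFlow.Sym11 𝔤, HermitianFlow.IsPos h₀ →
        ∀ (T : EReal) (h : ℝ → HermitianFlow.Sym11 𝔤), HermitianFlow.IsMaximalSolution h₀ T h →
          T = ⊤ ∧ ∃ C K : ℝ, ∀ t : ℝ, 0 ≤ t →
            HermitianFlow.FormLT (h t) ((C * Real.exp (K * t)) • h₀),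
      ∃ h₀ : HermitianFlow.Sym11 𝔤, HermitianFlow.IsPos h₀ ∧
        ∃ (T : EReal) (h : ℝ → HermitianFlow.Sym11 𝔤), HermitianFlow.IsMaximalSolution h₀ T h ∧
          T = ⊤] ∧
    (¬ LieAlgebra.IsSolvable 𝔤 →
      ∀ h₀ : HermitianFlow.Sym11 𝔤, HermitianFlow.IsPos h₀ →
        ∀ (T : EReal) (h : ℝ → HermitianFlow.Sym11 𝔤), HermitianFlow.IsMaximalSolution h₀ T h →
          ∃ τ : ℝ, T = (τ : EReal) ∧ ∃ ξ : Module.Dual ℂ 𝔤,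
            Filter.Tendsto (fun t => ((h t : HermitianFlow.Sesq 𝔤) ξ ξ).re)
              (𝓝[<] τ) Filter.atTop) := by
  refine ⟨fun h₀ _ => ?_, ?_, fun h𝔤 h₀ hpos T h hh => ?_⟩
  · obtain ⟨T, h, hh⟩ := HermitianFlow.exists_isMaximalSolution h₀
    refine ⟨T, h, hh, fun T' k hk t ht htT' => ?_⟩
    exact hk.eq hh.2.1 ht htT' (htT'.trans_le (hh.2.2 T' k hk))
  · tfae_have 1 → 2 := fun _ h₀ hpos T h hh => by
      obtain rfl := hh.eq_top hpos
      exact ⟨rfl, hh.2.1.exists_formLT hpos⟩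
    tfae_have 2 → 3 := fun H => by
      obtain ⟨h₀, hpos⟩ := HermitianFlow.exists_isPos 𝔤
      obtain ⟨T, h, hh⟩ := HermitianFlow.exists_isMaximalSolution h₀
      exact ⟨h₀, hpos, T, h, hh, (H h₀ hpos T h hh).1⟩
    tfae_have 3 → 1 := fun ⟨h₀, hpos, T, h, hh, hT⟩ => by
      by_contra h𝔤
      exact hh.2.1.ne_top h𝔤 hpos hT
    tfae_finish
  · have hT := hh.2.1.ne_top h𝔤 hpos
    lift T to ℝ using ⟨hT, (bot_lt_of_lt hh.1).ne'⟩
    exact ⟨T, rfl, hh.exists_tendsto_atTop hpos⟩
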